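/- Let $(\mathcal M,\circ,I,\bullet,J)$ be a duoidal category: two (not necessarily strict) monoidal structures, morphisms $\delta:I\to I\bullet I$, $\varpi:J\circ J\to J$, $\tau:I\to J$ making $(J,\varpi,\tau)$ a $\circ$-monoid and $(I,\delta,\tau)$ a $\bullet$-comonoid, and a natural interchange law $\zeta:(A\bullet B)\circ(C\bullet D)\to(A\circ C)\bullet(B\circ D)$ which is associative and unital with respect to both products. Associators and unitors are suppressed below. Assume that idempotent morphisms in $\mathcal M$ split. Let $A$ be a weak bimonoid in $\mathcal M$: an object with a $\circ$-monoid structure $(\mu,\eta)$ and a $\bullet$-comonoid structure $(\Delta,\varepsilon)$ such that $\Delta\mu=(\mu\bullet\mu)\,\zeta\,(\Delta\circ\Delta)$ and the following eight conditions hold. Put $\Delta_I=(I\bullet\Delta\eta)\delta:I\to I\bullet A\bullet A$, $\varepsilon_J=\varpi(J\circ\varepsilon\mu):J\circ A\circ A\to J$, ${}_I\Delta=(\Delta\eta\bullet I)\delta:I\to A\bullet A\bullet I$ and ${}_J\varepsilon=\varpi(\varepsilon\mu\circ J):A\circ A\circ J\to J$. * (RRU), (RLU): $(I\bullet A\bullet\Delta)(I\bullet\Delta)(I\bullet\eta)\delta$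 equals both $\big((I\bullet A\bullet\mu)\,\zeta\,((I\bullet A)\circ\Delta_I)\bullet A\big)\Delta_I$ and $\big((I\bullet A\bullet\mu)\,\zeta\,(\Delta_I\circ(I\bullet A))\bullet A\big)\Delta_I$. Here $\zeta$ goes from $(I\bullet A)\circ((I\bullet A)\bullet A)$, respectively $((I\bullet A)\bullet A)\circ(I\bullet A)$, to $(I\bullet A)\bullet(A\circ A)$. * (LRU), (LLU): the images of these two conditions under reversing $\bullet$ (so that ${}_I\Delta$ replaces $\Delta_I$). * (LLC), (LRC): $\varpi(J\circ\varepsilon)(J\circ\mu)(J\circ A\circ\mu):J\circ A\circ A\circ A\to J$ equals both $\varepsilon_J\big(((J\circ A)\bullet\varepsilon_J)\,\zeta\,((J\circ A)\circ\Delta)\circ A\big)$ and $\varepsilon_J\big((\varepsilon_J\bullet(J\circ A))\,\zeta\,((J\circ A)\circ\Delta)\circ A\big)$. Here $J\circ A$ is read as $J\bullet(J\circ A)$, respectively $(J\circ A)\bullet J$, before applying $\zeta$. * (RLC), (RRC): the images of (LLC), (LRC), respectively, under reversing $\circ$ (so that ${}_J\varepsilon$ replaces $\varepsilon_J$). Then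 the following four endomorphisms are idempotent: $$\begin{aligned} \sqcap^R_\circ&=\big((J\circ A)\bullet\varepsilon_J\big)\,\zeta\,\big((J\circ A)\circ\Delta\eta\big):J\circ A\to J\circ A,\\ \sqcap^L_\circ&=\big({}_J\varepsilon\bullet(A\circ J)\big)\,\zeta\,\big(\Delta\eta\circ(A\circ J)\big):A\circ J\to A\circ J,\\ \sqcap^R_\bullet&=\big((I\bullet A)\bullet\varepsilon\mu\big)\,\zeta\,\big((I\bullet A)\circ\Delta_I\big):I\bullet A\to I\bullet A,\\ \sqcap^L_\bullet&=\big(\varepsilon\mu\bullet(A\bullet I)\big)\,\zeta\,\big({}_I\Delta\circ(A\bullet I)\big):A\bullet I\to A\bullet I. \end{aligned}$$ Let $R_\circ,L_\circ,R_\bullet,L_\bullet$ be the objects of any splittings of them, with epimorphisms $\pi$ and monomorphisms $\iota$. They carry the following structures. * $R_\circ$ is a $J$-$A$ bimodule (for $\circ$) with actions $\pi(\varpi\circ A)(J\circ\iota)$ and $\pi(J\circ\mu)(\iota\circ A)$; symmetrically, $L_\circ$ is an $A$-$J$ bimodule. They are comonoids for $\bullet$. With $\chi=(\text{action}\bullet\text{action})\,\zeta\,((R_\circ\bullet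 R_\circ)\circ\Delta\eta)$, the comultiplication of $R_\circ$ is $\chi\,(R_\circ\bullet\pi(J\circ\eta))$ and its counit is $\varpi(J\circ\varepsilon)\iota$; the structure of $L_\circ$ is symmetric. There are comonoid morphisms $\pi(\tau\circ A):A\to R_\circ$ and $\pi(A\circ\tau):A\to L_\circ$. * Dually, $R_\bullet$ is an $I$-$A$ bicomodule (for $\bullet$) with coactions $(I\bullet\pi)(\delta\bullet A)\iota$ and $(\pi\bullet A)(I\bullet\Delta)\iota$; symmetrically, $L_\bullet$ is an $A$-$I$ bicomodule. They are monoids for $\circ$. With $\chi=((R_\bullet\circ R_\bullet)\bullet\varepsilon\mu)\,\zeta\,(\text{coaction}\circ\text{coaction})$, the multiplication of $R_\bullet$ is $(R_\bullet\circ(I\bullet\varepsilon)\iota)\,\chi$ and its unit is $\pi(I\bullet\eta)\delta$; the structure of $L_\bullet$ is symmetric. There are monoid morphisms $(\tau\bullet A)\iota:R_\bullet\to A$ and $(A\bullet\tau)\iota:L_\bullet\to A$. (Co)restricting the above $A$-(co)actions along these (co)monoid morphisms, and equipping the products below with the regular (co)actions of the base (co)monoids and the (co)actions of $J$, $I$ by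 $\varpi$, $\delta$, one obtains bimodules and bicomodules, and the following isomorphisms exist: 1. $L_\circ\cong L_\bullet\circ J$ as $L_\bullet$-$J$ bimodules; 2. $L_\circ\cong R_\bullet\circ J$ as $R_\bullet$-$J$ bimodules; 3. $R_\circ\cong J\circ R_\bullet$ as $J$-$R_\bullet$ bimodules; 4. $R_\circ\cong J\circ L_\bullet$ as $J$-$L_\bullet$ bimodules; 5. $L_\bullet\cong L_\circ\bullet I$ as $L_\circ$-$I$ bicomodules; 6. $L_\bullet\cong R_\circ\bullet I$ as $R_\circ$-$I$ bicomodules; 7. $R_\bullet\cong I\bullet R_\circ$ as $I$-$R_\circ$ bicomodules; 8. $R_\bullet\cong I\bullet L_\circ$ as $I$-$L_\circ$ bicomodules. -/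

import Mathlib

open CategoryTheory

universe v u

namespace Duoidal

section Basic

/-- A category carrying two (not necessarily strict) monoidal structures: `circ` with product
`⊚` and unit `uI`, and `bul` with product `⊙` and unit `uJ`. -/
class TwoMonoidal (C : Type u) [Category.{v} C] where
  circ : MonoidalCategory C
  bul : MonoidalCategory C

variable {C : Type u} [Category.{v} C] [TwoMonoidal C]

/-- The first monoidal product. -/
abbrev objO (X Y : C) : C := (TwoMonoidal.circ (C := C)).tensorObj X Y

/-- The second monoidal product. -/
abbrev objB (X Y : C) : C := (TwoMonoidal.bul (C := C)).tensorObj X Y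

infixr:70 " ⊚ " => objO
infixr:70 " ⊙ " => objB

variable (C) in
/-- The unit of the first monoidal product. -/
abbrev uI : C := (TwoMonoidal.circ (C := C)).tensorUnit

variable (C) in
/-- The unit of the second monoidal product. -/
abbrev uJ : C := (TwoMonoidal.bul (C := C)).tensorUnit

/-- The morphism `X ⊚ f`. -/
abbrev leftO (X : C) {Y Z : C} (f : Y ⟶ Z) : X ⊚ Y ⟶ X ⊚ Z :=
  (TwoMonoidal.circ (C := C)).whiskerLeft X f

/-- The morphism `f ⊚ X`. -/
abbrev rightO {Y Z : C} (f : Y ⟶ Z) (X : C) : Y ⊚ X ⟶ Z ⊚ X :=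
  (TwoMonoidal.circ (C := C)).whiskerRight f X

/-- The morphism `f ⊚ g`. -/
abbrev homO {W X Y Z : C} (f : W ⟶ X) (g : Y ⟶ Z) : W ⊚ Y ⟶ X ⊚ Z :=
  (TwoMonoidal.circ (C := C)).tensorHom f g

/-- The morphism `X ⊙ f`. -/
abbrev leftB (X : C) {Y Z : C} (f : Y ⟶ Z) : X ⊙ Y ⟶ X ⊙ Z :=
  (TwoMonoidal.bul (C := C)).whiskerLeft X f

/-- The morphism `f ⊙ X`. -/
abbrev rightB {Y Z : C} (f : Y ⟶ Z) (X : C) : Y ⊙ X ⟶ Z ⊙ X :=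
  (TwoMonoidal.bul (C := C)).whiskerRight f X

/-- The morphism `f ⊙ g`. -/
abbrev homB {W X Y Z : C} (f : W ⟶ X) (g : Y ⟶ Z) : W ⊙ Y ⟶ X ⊙ Z :=
  (TwoMonoidal.bul (C := C)).tensorHom f g

infixr:81 " ◁ₒ " => leftO
infixl:81 " ▷ₒ " => rightO
infixr:70 " ⊚ₘ " => homO
infixr:81 " ◁ᵦ " => leftB
infixl:81 " ▷ᵦ " => rightB
infixr:70 " ⊙ₘ " => homB

/-- Associator and unitors of the first monoidal structure. -/
abbrev assocO (X Y Z : C) : (X ⊚ Y) ⊚ Z ≅ X ⊚ (Y ⊚ Z) :=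
  (TwoMonoidal.circ (C := C)).associator X Y Z
abbrev lunitO (X : C) : uI C ⊚ X ≅ X := (TwoMonoidal.circ (C := C)).leftUnitor X
abbrev runitO (X : C) : X ⊚ uI C ≅ X := (TwoMonoidal.circ (C := C)).rightUnitor X

/-- Associator and unitors of the second monoidal structure. -/
abbrev assocB (X Y Z : C) : (X ⊙ Y) ⊙ Z ≅ X ⊙ (Y ⊙ Z) :=
  (TwoMonoidal.bul (C := C)).associator X Y Z
abbrev lunitB (X : C) : uJ C ⊙ X ≅ X := (TwoMonoidal.bul (C := C)).leftUnitor X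
abbrev runitB (X : C) : X ⊙ uJ C ≅ X := (TwoMonoidal.bul (C := C)).rightUnitor X

end Basic

/-- A duoidal (2-monoidal) category. -/
class DuoidalCategory (C : Type u) [Category.{v} C] extends TwoMonoidal C where
  δ : uI C ⟶ uI C ⊙ uI C
  ϖ : uJ C ⊚ uJ C ⟶ uJ C
  τ : uI C ⟶ uJ C
  /-- The interchange law. -/
  ζ (X Y Z W : C) : (X ⊙ Y) ⊚ (Z ⊙ W) ⟶ (X ⊚ Z) ⊙ (Y ⊚ W)
  ζ_natural {X X' Y Y' Z Z' W W' : C} (f : X ⟶ X') (g : Y ⟶ Y') (h : Z ⟶ Z') (k : W ⟶ W') :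
    ((f ⊙ₘ g) ⊚ₘ (h ⊙ₘ k)) ≫ ζ X' Y' Z' W' = ζ X Y Z W ≫ ((f ⊚ₘ h) ⊙ₘ (g ⊚ₘ k))
  -- `(uJ, ϖ, τ)` is a monoid for `⊚`
  τ_ϖ : τ ▷ₒ uJ C ≫ ϖ = (lunitO (uJ C)).hom
  ϖ_τ : uJ C ◁ₒ τ ≫ ϖ = (runitO (uJ C)).hom
  ϖ_assoc : ϖ ▷ₒ uJ C ≫ ϖ = (assocO (uJ C) (uJ C) (uJ C)).hom ≫ uJ C ◁ₒ ϖ ≫ ϖ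
  -- `(uI, δ, τ)` is a comonoid for `⊙`
  δ_τ_left : δ ≫ τ ▷ᵦ uI C = (lunitB (uI C)).inv
  δ_τ_right : δ ≫ uI C ◁ᵦ τ = (runitB (uI C)).inv
  δ_coassoc : δ ≫ uI C ◁ᵦ δ = δ ≫ δ ▷ᵦ uI C ≫ (assocB (uI C) (uI C) (uI C)).hom
  -- associativity
  ζ_assocO (X Y Z W U V : C) :
    ζ X Y Z W ▷ₒ (U ⊙ V) ≫ ζ (X ⊚ Z) (Y ⊚ W) U V ≫ ((assocO X Z U).hom ⊙ₘ (assocO Y W V).hom) =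
      (assocO (X ⊙ Y) (Z ⊙ W) (U ⊙ V)).hom ≫ (X ⊙ Y) ◁ₒ ζ Z W U V ≫ ζ X Y (Z ⊚ U) (W ⊚ V)
  ζ_assocB (X Y Z U V W : C) :
    ζ (X ⊙ Y) Z (U ⊙ V) W ≫ ζ X Y U V ▷ᵦ (Z ⊚ W) ≫ (assocB (X ⊚ U) (Y ⊚ V) (Z ⊚ W)).hom =
      ((assocB X Y Z).hom ⊚ₘ (assocB U V W).hom) ≫ ζ X (Y ⊙ Z) U (V ⊙ W) ≫
        (X ⊚ U) ◁ᵦ ζ Y Z V W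
  -- unitality
  ζ_unit_leftO (X Y : C) :
    (lunitO (X ⊙ Y)).inv ≫ δ ▷ₒ (X ⊙ Y) ≫ ζ (uI C) (uI C) X Y ≫
      ((lunitO X).hom ⊙ₘ (lunitO Y).hom) = 𝟙 (X ⊙ Y)
  ζ_unit_rightO (X Y : C) :
    (runitO (X ⊙ Y)).inv ≫ (X ⊙ Y) ◁ₒ δ ≫ ζ X Y (uI C) (uI C) ≫
      ((runitO X).hom ⊙ₘ (runitO Y).hom) = 𝟙 (X ⊙ Y)
  ζ_unit_leftB (X Y : C) :
    ((lunitB X).inv ⊚ₘ (lunitB Y).inv) ≫ ζ (uJ C) X (uJ C) Y ≫ ϖ ▷ᵦ (X ⊚ Y) ≫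
      (lunitB (X ⊚ Y)).hom = 𝟙 (X ⊚ Y)
  ζ_unit_rightB (X Y : C) :
    ((runitB X).inv ⊚ₘ (runitB Y).inv) ≫ ζ X (uJ C) Y (uJ C) ≫ (X ⊚ Y) ◁ᵦ ϖ ≫
      (runitB (X ⊚ Y)).hom = 𝟙 (X ⊚ Y)

open DuoidalCategory

section Bimonoids

variable {C : Type u} [Category.{v} C] [DuoidalCategory C]

/-- An object carrying a monoid structure with respect to `⊚` and a comonoid structure with
respect to `⊙` (with no compatibility yet). -/
class MonComon (A : C) where
  monObj : @MonObj C _ TwoMonoidal.circ A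
  comonObj : @ComonObj C _ TwoMonoidal.bul A

variable (A : C) [MonComon A]

abbrev μA : A ⊚ A ⟶ A := (MonComon.monObj (A := A)).mul
abbrev ηA : uI C ⟶ A := (MonComon.monObj (A := A)).one
abbrev ΔA : A ⟶ A ⊙ A := (MonComon.comonObj (A := A)).comul
abbrev εA : A ⟶ uJ C := (MonComon.comonObj (A := A)).counit

/-- The composite `Δ.η`. -/
def Δη : uI C ⟶ A ⊙ A := ηA A ≫ ΔA A

/-- The composite `ε.μ`. -/
def εμ : A ⊚ A ⟶ uJ C := μA A ≫ εA A

/-- `I → I ⊙ I → I ⊙ A ⊙ A`, bracketed to the left. -/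
def IΔη : uI C ⟶ (uI C ⊙ A) ⊙ A :=
  δ ≫ uI C ◁ᵦ Δη A ≫ (assocB (uI C) A A).inv

/-- `I → I ⊙ I → A ⊙ A ⊙ I`, bracketed to the right. -/
def ΔηI : uI C ⟶ A ⊙ (A ⊙ uI C) :=
  δ ≫ Δη A ▷ᵦ uI C ≫ (assocB A A (uI C)).hom

/-- `J ⊚ A ⊚ A → J ⊚ J → J`, bracketed to the left. -/
def Jεμ : (uJ C ⊚ A) ⊚ A ⟶ uJ C :=
  (assocO (uJ C) A A).hom ≫ uJ C ◁ₒ εμ A ≫ ϖ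

/-- `A ⊚ A ⊚ J → J ⊚ J → J`, bracketed to the right. -/
def εμJ : A ⊚ (A ⊚ uJ C) ⟶ uJ C :=
  (assocO A A (uJ C)).inv ≫ εμ A ▷ₒ uJ C ≫ ϖ

/-- Multiplicativity of the comultiplication. -/
def AxWB : Prop :=
  μA A ≫ ΔA A = (ΔA A ⊚ₘ ΔA A) ≫ ζ A A A A ≫ (μA A ⊙ₘ μA A)

/-- The morphism `I → I ⊙ I → I ⊙ A → I ⊙ A ⊙ A → I ⊙ A ⊙ A ⊙ A` occurring in the weak unit
conditions (RRU) and (RLU). -/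
def unitR : uI C ⟶ uI C ⊙ (A ⊙ (A ⊙ A)) :=
  δ ≫ uI C ◁ᵦ ηA A ≫ uI C ◁ᵦ ΔA A ≫ uI C ◁ᵦ (A ◁ᵦ ΔA A)

/-- The morphism `I → I ⊙ I → A ⊙ I → A ⊙ A ⊙ I → A ⊙ A ⊙ A ⊙ I` occurring in the weak unit
conditions (LRU) and (LLU). -/
def unitL : uI C ⟶ ((A ⊙ A) ⊙ A) ⊙ uI C :=
  δ ≫ ηA A ▷ᵦ uI C ≫ ΔA A ▷ᵦ uI C ≫ (ΔA A ▷ᵦ A) ▷ᵦ uI C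

/-- The morphism `J ⊚ A ⊚ A ⊚ A → J ⊚ A ⊚ A → J ⊚ A → J ⊚ J → J` occurring in the weak counit
conditions (LRC) and (LLC). -/
def counitL : uJ C ⊚ (A ⊚ (A ⊚ A)) ⟶ uJ C :=
  uJ C ◁ₒ (A ◁ₒ μA A) ≫ uJ C ◁ₒ μA A ≫ uJ C ◁ₒ εA A ≫ ϖ

/-- The morphism `A ⊚ A ⊚ A ⊚ J → A ⊚ A ⊚ J → A ⊚ J → J ⊚ J → J` occurring in the weak counit
conditions (RRC) and (RLC). -/
def counitR : ((A ⊚ A) ⊚ A) ⊚ uJ C ⟶ uJ C :=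
  (μA A ▷ₒ A) ▷ₒ uJ C ≫ μA A ▷ₒ uJ C ≫ εA A ▷ₒ uJ C ≫ ϖ

def AxRRU : Prop :=
  IΔη A ≫
    ((runitO (uI C ⊙ A)).inv ≫ (uI C ⊙ A) ◁ₒ IΔη A ≫ ζ (uI C) A (uI C ⊙ A) A ≫
      (lunitO (uI C ⊙ A)).hom ▷ᵦ (A ⊚ A) ≫ (uI C ⊙ A) ◁ᵦ μA A) ▷ᵦ A ≫
    (assocB (uI C ⊙ A) A A).hom ≫ (assocB (uI C) A (A ⊙ A)).hom = unitR A

def AxRLU : Prop :=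
  IΔη A ≫
    ((lunitO (uI C ⊙ A)).inv ≫ IΔη A ▷ₒ (uI C ⊙ A) ≫ ζ (uI C ⊙ A) A (uI C) A ≫
      (runitO (uI C ⊙ A)).hom ▷ᵦ (A ⊚ A) ≫ (uI C ⊙ A) ◁ᵦ μA A) ▷ᵦ A ≫
    (assocB (uI C ⊙ A) A A).hom ≫ (assocB (uI C) A (A ⊙ A)).hom = unitR A

def AxLRU : Prop :=
  ΔηI A ≫
    A ◁ᵦ ((runitO (A ⊙ uI C)).inv ≫ (A ⊙ uI C) ◁ₒ ΔηI A ≫ ζ A (uI C) A (A ⊙ uI C) ≫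
      (A ⊚ A) ◁ᵦ (lunitO (A ⊙ uI C)).hom ≫ μA A ▷ᵦ (A ⊙ uI C)) ≫
    (assocB A A (A ⊙ uI C)).inv ≫ (assocB (A ⊙ A) A (uI C)).inv = unitL A

def AxLLU : Prop :=
  ΔηI A ≫
    A ◁ᵦ ((lunitO (A ⊙ uI C)).inv ≫ ΔηI A ▷ₒ (A ⊙ uI C) ≫ ζ A (A ⊙ uI C) A (uI C) ≫
      (A ⊚ A) ◁ᵦ (runitO (A ⊙ uI C)).hom ≫ μA A ▷ᵦ (A ⊙ uI C)) ≫
    (assocB A A (A ⊙ uI C)).inv ≫ (assocB (A ⊙ A) A (uI C)).inv = unitL A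

def AxLRC : Prop :=
  (assocO (uJ C) A (A ⊚ A)).inv ≫ (assocO (uJ C ⊚ A) A A).inv ≫
    ((uJ C ⊚ A) ◁ₒ ΔA A ≫ (runitB (uJ C ⊚ A)).inv ▷ₒ (A ⊙ A) ≫ ζ (uJ C ⊚ A) (uJ C) A A ≫
      Jεμ A ▷ᵦ (uJ C ⊚ A) ≫ (lunitB (uJ C ⊚ A)).hom) ▷ₒ A ≫
    Jεμ A = counitL A

def AxLLC : Prop :=
  (assocO (uJ C) A (A ⊚ A)).inv ≫ (assocO (uJ C ⊚ A) A A).inv ≫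
    ((uJ C ⊚ A) ◁ₒ ΔA A ≫ (lunitB (uJ C ⊚ A)).inv ▷ₒ (A ⊙ A) ≫ ζ (uJ C) (uJ C ⊚ A) A A ≫
      (uJ C ⊚ A) ◁ᵦ Jεμ A ≫ (runitB (uJ C ⊚ A)).hom) ▷ₒ A ≫
    Jεμ A = counitL A

def AxRRC : Prop :=
  (assocO (A ⊚ A) A (uJ C)).hom ≫ (assocO A A (A ⊚ uJ C)).hom ≫
    A ◁ₒ (ΔA A ▷ₒ (A ⊚ uJ C) ≫ (A ⊙ A) ◁ₒ (runitB (A ⊚ uJ C)).inv ≫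
      ζ A A (A ⊚ uJ C) (uJ C) ≫ εμJ A ▷ᵦ (A ⊚ uJ C) ≫ (lunitB (A ⊚ uJ C)).hom) ≫
    εμJ A = counitR A

def AxRLC : Prop :=
  (assocO (A ⊚ A) A (uJ C)).hom ≫ (assocO A A (A ⊚ uJ C)).hom ≫
    A ◁ₒ (ΔA A ▷ₒ (A ⊚ uJ C) ≫ (A ⊙ A) ◁ₒ (lunitB (A ⊚ uJ C)).inv ≫
      ζ A A (uJ C) (A ⊚ uJ C) ≫ (A ⊚ uJ C) ◁ᵦ εμJ A ≫ (runitB (A ⊚ uJ C)).hom) ≫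
    εμJ A = counitR A

structure IsRightWeakBimonoid : Prop where
  wb : AxWB A
  rru : AxRRU A
  lru : AxLRU A
  lrc : AxLRC A
  llc : AxLLC A

structure IsLeftWeakBimonoid : Prop where
  wb : AxWB A
  rlu : AxRLU A
  llu : AxLLU A
  rlc : AxRLC A
  rrc : AxRRC A

structure IsWeakBimonoid : Prop where
  right : IsRightWeakBimonoid A
  left : IsLeftWeakBimonoid A

/-! The four idempotents whose splittings are the base objects. -/

def sqcapRo : uJ C ⊚ A ⟶ uJ C ⊚ A :=
  (runitO (uJ C ⊚ A)).inv ≫ (uJ C ⊚ A) ◁ₒ Δη A ≫ (lunitB (uJ C ⊚ A)).inv ▷ₒ (A ⊙ A) ≫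
    ζ (uJ C) (uJ C ⊚ A) A A ≫ (uJ C ⊚ A) ◁ᵦ Jεμ A ≫ (runitB (uJ C ⊚ A)).hom

def sqcapLo : A ⊚ uJ C ⟶ A ⊚ uJ C :=
  (lunitO (A ⊚ uJ C)).inv ≫ Δη A ▷ₒ (A ⊚ uJ C) ≫ (A ⊙ A) ◁ₒ (runitB (A ⊚ uJ C)).inv ≫
    ζ A A (A ⊚ uJ C) (uJ C) ≫ εμJ A ▷ᵦ (A ⊚ uJ C) ≫ (lunitB (A ⊚ uJ C)).hom

def sqcapRb : uI C ⊙ A ⟶ uI C ⊙ A :=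
  (runitO (uI C ⊙ A)).inv ≫ (uI C ⊙ A) ◁ₒ IΔη A ≫ ζ (uI C) A (uI C ⊙ A) A ≫
    (lunitO (uI C ⊙ A)).hom ▷ᵦ (A ⊚ A) ≫ (uI C ⊙ A) ◁ᵦ εμ A ≫ (runitB (uI C ⊙ A)).hom

def sqcapLb : A ⊙ uI C ⟶ A ⊙ uI C :=
  (lunitO (A ⊙ uI C)).inv ≫ ΔηI A ▷ₒ (A ⊙ uI C) ≫ ζ A (A ⊙ uI C) A (uI C) ≫
    (A ⊚ A) ◁ᵦ (runitO (A ⊙ uI C)).hom ≫ εμ A ▷ᵦ (A ⊙ uI C) ≫ (lunitB (A ⊙ uI C)).hom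

end Bimonoids

/-- A splitting of an endomorphism `p` through the object `obj`. -/
structure Splitting {C : Type u} [Category.{v} C] {X : C} (p : X ⟶ X) where
  obj : C
  ι : obj ⟶ X
  π : X ⟶ obj
  ι_π : ι ≫ π = 𝟙 obj
  π_ι : π ≫ ι = p

section Modules

variable (C : Type u) [Category.{v} C] [DuoidalCategory C]

/-- The data of a monoid for `⊚`. -/
structure PreMon where
  X : C
  mul : X ⊚ X ⟶ X
  one : uI C ⟶ X

/-- The data of a comonoid for `⊙`. -/
structure PreComon where
  X : C
  comul : X ⟶ X ⊙ X
  counit : X ⟶ uJ C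

variable {C}

/-- The data `M` satisfy the monoid axioms in `(C, ⊚, uI)`. -/
def PreMon.IsMonoid (M : PreMon C) : Prop :=
  ∃ m : @MonObj C _ TwoMonoidal.circ M.X, m.mul = M.mul ∧ m.one = M.one

/-- The data `M` satisfy the comonoid axioms in `(C, ⊙, uJ)`. -/
def PreComon.IsComonoid (M : PreComon C) : Prop :=
  ∃ m : @ComonObj C _ TwoMonoidal.bul M.X, m.comul = M.comul ∧ m.counit = M.counit

/-- An object with a left `M`-action and a right `N`-action (no axioms). -/
structure PreBimod (M N : PreMon C) where
  X : C
  left : M.X ⊚ X ⟶ X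
  right : X ⊚ N.X ⟶ X

/-- The `M`-`N` bimodule axioms in `(C, ⊚, uI)`. -/
structure PreBimod.IsBimodule {M N : PreMon C} (P : PreBimod M N) : Prop where
  one_left : M.one ▷ₒ P.X ≫ P.left = (lunitO P.X).hom
  mul_left : M.mul ▷ₒ P.X ≫ P.left = (assocO M.X M.X P.X).hom ≫ M.X ◁ₒ P.left ≫ P.left
  right_one : P.X ◁ₒ N.one ≫ P.right = (runitO P.X).hom
  right_mul : P.X ◁ₒ N.mul ≫ P.right = (assocO P.X N.X N.X).inv ≫ P.right ▷ₒ N.X ≫ P.right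
  middle : P.left ▷ₒ N.X ≫ P.right = (assocO M.X P.X N.X).hom ≫ M.X ◁ₒ P.right ≫ P.left

/-- `P` and `Q` are `M`-`N` bimodules, and they are isomorphic as such. -/
def IsoAsBimodules {M N : PreMon C} (P Q : PreBimod M N) : Prop :=
  P.IsBimodule ∧ Q.IsBimodule ∧ ∃ e : P.X ≅ Q.X,
    P.left ≫ e.hom = M.X ◁ₒ e.hom ≫ Q.left ∧ P.right ≫ e.hom = e.hom ▷ₒ N.X ≫ Q.right

/-- An object with a left `M`-coaction and a right `N`-coaction (no axioms). -/
structure PreBicomod (M N : PreComon C) where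
  X : C
  left : X ⟶ M.X ⊙ X
  right : X ⟶ X ⊙ N.X

/-- The `M`-`N` bicomodule axioms in `(C, ⊙, uJ)`. -/
structure PreBicomod.IsBicomodule {M N : PreComon C} (P : PreBicomod M N) : Prop where
  counit_left : P.left ≫ M.counit ▷ᵦ P.X = (lunitB P.X).inv
  comul_left : P.left ≫ M.comul ▷ᵦ P.X = P.left ≫ M.X ◁ᵦ P.left ≫ (assocB M.X M.X P.X).inv
  right_counit : P.right ≫ P.X ◁ᵦ N.counit = (runitB P.X).inv
  right_comul : P.right ≫ P.X ◁ᵦ N.comul = P.right ≫ P.right ▷ᵦ N.X ≫ (assocB P.X N.X N.X).hom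
  middle : P.right ≫ P.left ▷ᵦ N.X = P.left ≫ M.X ◁ᵦ P.right ≫ (assocB M.X P.X N.X).inv

/-- `P` and `Q` are `M`-`N` bicomodules, and they are isomorphic as such. -/
def IsoAsBicomodules {M N : PreComon C} (P Q : PreBicomod M N) : Prop :=
  P.IsBicomodule ∧ Q.IsBicomodule ∧ ∃ e : P.X ≅ Q.X,
    P.left ≫ M.X ◁ᵦ e.hom = e.hom ≫ Q.left ∧ P.right ≫ e.hom ▷ᵦ N.X = e.hom ≫ Q.right

variable (C) in
/-- The monoid `(uJ, ϖ, τ)` for `⊚`. -/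
def monJ : PreMon C := ⟨uJ C, ϖ, τ⟩

variable (C) in
/-- The comonoid `(uI, δ, τ)` for `⊙`. -/
def comonI : PreComon C := ⟨uI C, δ, τ⟩

/-- `M ⊚ J` with the regular left `M`-action and the right `J`-action by `ϖ`. -/
def tensorJ (M : PreMon C) : PreBimod M (monJ C) where
  X := M.X ⊚ uJ C
  left := (assocO M.X M.X (uJ C)).inv ≫ M.mul ▷ₒ uJ C
  right := (assocO M.X (uJ C) (uJ C)).hom ≫ M.X ◁ₒ ϖ

/-- `J ⊚ M` with the left `J`-action by `ϖ` and the regular right `M`-action. -/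
def Jtensor (M : PreMon C) : PreBimod (monJ C) M where
  X := uJ C ⊚ M.X
  left := (assocO (uJ C) (uJ C) M.X).inv ≫ ϖ ▷ₒ M.X
  right := (assocO (uJ C) M.X M.X).hom ≫ uJ C ◁ₒ M.mul

/-- `M ⊙ I` with the regular left `M`-coaction and the right `I`-coaction by `δ`. -/
def tensorI (M : PreComon C) : PreBicomod M (comonI C) where
  X := M.X ⊙ uI C
  left := M.comul ▷ᵦ uI C ≫ (assocB M.X M.X (uI C)).hom
  right := M.X ◁ᵦ δ ≫ (assocB M.X (uI C) (uI C)).inv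

/-- `I ⊙ M` with the left `I`-coaction by `δ` and the regular right `M`-coaction. -/
def Itensor (M : PreComon C) : PreBicomod (comonI C) M where
  X := uI C ⊙ M.X
  left := δ ▷ᵦ M.X ≫ (assocB (uI C) (uI C) M.X).hom
  right := uI C ◁ᵦ M.comul ≫ (assocB (uI C) M.X M.X).inv

end Modules

section BaseObjects

variable {C : Type u} [Category.{v} C] [DuoidalCategory C] {A : C} [MonComon A]

/-! ### The base object `R_∘` -/

section Ro

variable (S : Splitting (sqcapRo A))

/-- The right `A`-action. -/
def Ro.act : S.obj ⊚ A ⟶ S.obj :=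
  S.ι ▷ₒ A ≫ (assocO (uJ C) A A).hom ≫ uJ C ◁ₒ μA A ≫ S.π

/-- The left `J`-action. -/
def Ro.actJ : uJ C ⊚ S.obj ⟶ S.obj :=
  uJ C ◁ₒ S.ι ≫ (assocO (uJ C) (uJ C) A).inv ≫ ϖ ▷ₒ A ≫ S.π

/-- The idempotent `χ` on the `⊙`-square of the right `A`-module. -/
def Ro.χ : S.obj ⊙ S.obj ⟶ S.obj ⊙ S.obj :=
  (runitO (S.obj ⊙ S.obj)).inv ≫ (S.obj ⊙ S.obj) ◁ₒ Δη A ≫ ζ S.obj S.obj A A ≫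
    (Ro.act S ⊙ₘ Ro.act S)

/-- The comonoid structure for `⊙`. -/
def Ro.comon : PreComon C where
  X := S.obj
  comul := (runitB S.obj).inv ≫
    S.obj ◁ᵦ ((runitO (uJ C)).inv ≫ uJ C ◁ₒ ηA A ≫ S.π) ≫ Ro.χ S
  counit := S.ι ≫ uJ C ◁ₒ εA A ≫ ϖ

/-- The comonoid morphism `A → J ⊚ A → R_∘`. -/
def Ro.fromA : A ⟶ S.obj := (lunitO A).inv ≫ τ ▷ₒ A ≫ S.π

end Ro

/-! ### The base object `L_∘` -/

section Lo

variable (S : Splitting (sqcapLo A))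

/-- The left `A`-action. -/
def Lo.act : A ⊚ S.obj ⟶ S.obj :=
  A ◁ₒ S.ι ≫ (assocO A A (uJ C)).inv ≫ μA A ▷ₒ uJ C ≫ S.π

/-- The right `J`-action. -/
def Lo.actJ : S.obj ⊚ uJ C ⟶ S.obj :=
  S.ι ▷ₒ uJ C ≫ (assocO A (uJ C) (uJ C)).hom ≫ A ◁ₒ ϖ ≫ S.π

/-- The idempotent `χ` on the `⊙`-square of the left `A`-module. -/
def Lo.χ : S.obj ⊙ S.obj ⟶ S.obj ⊙ S.obj :=
  (lunitO (S.obj ⊙ S.obj)).inv ≫ Δη A ▷ₒ (S.obj ⊙ S.obj) ≫ ζ A A S.obj S.obj ≫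
    (Lo.act S ⊙ₘ Lo.act S)

/-- The comonoid structure for `⊙`. -/
def Lo.comon : PreComon C where
  X := S.obj
  comul := (lunitB S.obj).inv ≫
    ((lunitO (uJ C)).inv ≫ ηA A ▷ₒ uJ C ≫ S.π) ▷ᵦ S.obj ≫ Lo.χ S
  counit := S.ι ≫ εA A ▷ₒ uJ C ≫ ϖ

/-- The comonoid morphism `A → A ⊚ J → L_∘`. -/
def Lo.fromA : A ⟶ S.obj := (runitO A).inv ≫ A ◁ₒ τ ≫ S.π

end Lo

/-! ### The base object `R_•` -/

section Rb

variable (S : Splitting (sqcapRb A))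

/-- The right `A`-coaction. -/
def Rb.coact : S.obj ⟶ S.obj ⊙ A :=
  S.ι ≫ uI C ◁ᵦ ΔA A ≫ (assocB (uI C) A A).inv ≫ S.π ▷ᵦ A

/-- The left `I`-coaction. -/
def Rb.coactI : S.obj ⟶ uI C ⊙ S.obj :=
  S.ι ≫ δ ▷ᵦ A ≫ (assocB (uI C) (uI C) A).hom ≫ uI C ◁ᵦ S.π

/-- The idempotent `χ` on the `⊚`-square of the right `A`-comodule. -/
def Rb.χ : S.obj ⊚ S.obj ⟶ S.obj ⊚ S.obj :=
  (Rb.coact S ⊚ₘ Rb.coact S) ≫ ζ S.obj A S.obj A ≫ (S.obj ⊚ S.obj) ◁ᵦ εμ A ≫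
    (runitB (S.obj ⊚ S.obj)).hom

/-- The monoid structure for `⊚`. -/
def Rb.mon : PreMon C where
  X := S.obj
  mul := Rb.χ S ≫ S.obj ◁ₒ (S.ι ≫ uI C ◁ᵦ εA A ≫ (runitB (uI C)).hom) ≫ (runitO S.obj).hom
  one := δ ≫ uI C ◁ᵦ ηA A ≫ S.π

/-- The monoid morphism `R_• → I ⊙ A → A`. -/
def Rb.toA : S.obj ⟶ A := S.ι ≫ τ ▷ᵦ A ≫ (lunitB A).hom

end Rb

/-! ### The base object `L_•` -/

section Lb

variable (S : Splitting (sqcapLb A))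

/-- The left `A`-coaction. -/
def Lb.coact : S.obj ⟶ A ⊙ S.obj :=
  S.ι ≫ ΔA A ▷ᵦ uI C ≫ (assocB A A (uI C)).hom ≫ A ◁ᵦ S.π

/-- The right `I`-coaction. -/
def Lb.coactI : S.obj ⟶ S.obj ⊙ uI C :=
  S.ι ≫ A ◁ᵦ δ ≫ (assocB A (uI C) (uI C)).inv ≫ S.π ▷ᵦ uI C

/-- The idempotent `χ` on the `⊚`-square of the left `A`-comodule. -/
def Lb.χ : S.obj ⊚ S.obj ⟶ S.obj ⊚ S.obj :=
  (Lb.coact S ⊚ₘ Lb.coact S) ≫ ζ A S.obj A S.obj ≫ εμ A ▷ᵦ (S.obj ⊚ S.obj) ≫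
    (lunitB (S.obj ⊚ S.obj)).hom

/-- The monoid structure for `⊚`. -/
def Lb.mon : PreMon C where
  X := S.obj
  mul := Lb.χ S ≫ (S.ι ≫ εA A ▷ᵦ uI C ≫ (lunitB (uI C)).hom) ▷ₒ S.obj ≫ (lunitO S.obj).hom
  one := δ ≫ ηA A ▷ᵦ uI C ≫ S.π

/-- The monoid morphism `L_• → A ⊙ I → A`. -/
def Lb.toA : S.obj ⟶ A := S.ι ≫ A ◁ᵦ τ ≫ (runitB A).hom

end Lb

/-! ### Bimodule and bicomodule structures on the base objects -/

/-- `L_∘` as an `M`-`J` bimodule, its left `A`-action being restricted along `f : M → A`. -/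
def Lo.bimod (S : Splitting (sqcapLo A)) (M : PreMon C) (f : M.X ⟶ A) :
    PreBimod M (monJ C) where
  X := S.obj
  left := f ▷ₒ S.obj ≫ Lo.act S
  right := Lo.actJ S

/-- `R_∘` as a `J`-`M` bimodule, its right `A`-action being restricted along `f : M → A`. -/
def Ro.bimod (S : Splitting (sqcapRo A)) (M : PreMon C) (f : M.X ⟶ A) :
    PreBimod (monJ C) M where
  X := S.obj
  left := Ro.actJ S
  right := S.obj ◁ₒ f ≫ Ro.act S

/-- `L_•` as an `M`-`I` bicomodule, its left `A`-coaction being corestricted along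
`f : A → M`. -/
def Lb.bicomod (S : Splitting (sqcapLb A)) (M : PreComon C) (f : A ⟶ M.X) :
    PreBicomod M (comonI C) where
  X := S.obj
  left := Lb.coact S ≫ f ▷ᵦ S.obj
  right := Lb.coactI S

/-- `R_•` as an `I`-`M` bicomodule, its right `A`-coaction being corestricted along
`f : A → M`. -/
def Rb.bicomod (S : Splitting (sqcapRb A)) (M : PreComon C) (f : A ⟶ M.X) :
    PreBicomod (comonI C) M where
  X := S.obj
  left := Rb.coactI S
  right := Rb.coact S ≫ S.obj ◁ᵦ f

end BaseObjects

end Duoidal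

open Duoidal

/-! Write elements in Sweedler style, suppressing `I` and `J`, with `1_1 • 1_2` for `IΔη`. The
`•`-product of two `∘`-monoids is a `∘`-monoid, so `I • A` and `(I • A) • A` are monoids. The
coaction `coactIA` is multiplicative because `Δ` is, but not unital: it sends the unit to the
idempotent element `IΔη`. The idempotent `sqcapRb` is `x ↦ 1_1 ε(x 1_2)`. By (RRU) and (RLU) every
`x` in its image satisfies `Δx = (1 • x) Δ1 = Δ1 (1 • x)`, and an `x` satisfying the first equation
is fixed. Such elements are closed under multiplication (`Rb.conv_ι_sqcapRb`), so `R_•` is a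
submonoid of `I • A`, with product `x_1 ε(x_2 y) = xy` (`Rb.mul_ι`).

The isomorphism `R_∘ ≅ J ∘ R_•` comes from two maps between `J ∘ A` and `J ∘ (I • A)`: `J ∘ toAIA`,
and `comparison`, which is `a ↦ 1_1 ε(a 1_2)`. Their two composites are exactly `sqcapRo` and `J ∘
sqcapRb` (`comparison_toAIA`, `leftO_toAIA_comparison`), so they become mutually inverse after
splitting. Condition (LLC) says that `sqcapRo` is invisible to the form `ε(a b)` (`sqcapRo_Jεμ`).
Since `sqcapRo` and `comparison` depend on `a` only through this form, `sqcapRo` is idempotent and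
compatible with the actions. For `R_∘ ≅ J ∘ L_•` the comparison morphism of the `•`-reversed
category is used; its idempotents differ from `sqcapLb` and `sqcapRo`, but absorb them in the
required order.

Everything else is symmetry. The axioms are stable under reversing either product and under passing
to the opposite category with the products interchanged. Duality turns the statements on monoids and
bimodules into those on comonoids and bicomodules; reversing both products exchanges the letters `R`
and `L`. -/

namespace Duoidal

open DuoidalCategory

/-! ### Calculus of generalized elements of a monoid. -/

section MonoidalGeneral

open MonoidalCategory

variable {D : Type u} [Category.{v} D] [MonoidalCategory D]

/-- The product of two generalized elements of a monoid. -/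
def conv {X Y M : D} [MonObj M] (f : X ⟶ M) (g : Y ⟶ M) : X ⊗ Y ⟶ M :=
  (f ⊗ₘ g) ≫ MonObj.mul

/-- Multiplication of a generalized element by a global element on the right. -/
def rAct {X M : D} [MonObj M] (f : X ⟶ M) (e : 𝟙_ D ⟶ M) : X ⟶ M :=
  (ρ_ X).inv ≫ conv f e

/-- Multiplication of a generalized element by a global element on the left. -/
def lAct {X M : D} [MonObj M] (e : 𝟙_ D ⟶ M) (f : X ⟶ M) : X ⟶ M :=
  (λ_ X).inv ≫ conv e f

/-- Compatibility of a morphism with the multiplications of two monoids. -/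
def IsMul {M N : D} [MonObj M] [MonObj N] (f : M ⟶ N) : Prop :=
  MonObj.mul ≫ f = (f ⊗ₘ f) ≫ MonObj.mul

variable {X Y Z M N : D} [MonObj M] [MonObj N]

lemma conv_eq_left (f : X ⟶ M) (g : Y ⟶ M) : conv f g = f ▷ Y ≫ M ◁ g ≫ MonObj.mul := by
  simp [conv, MonoidalCategory.tensorHom_def]

lemma conv_assoc (f : X ⟶ M) (g : Y ⟶ M) (h : Z ⟶ M) :
    conv (conv f g) h = (α_ X Y Z).hom ≫ conv f (conv g h) := by
  have h1 : conv (conv f g) h = ((f ⊗ₘ g) ⊗ₘ h) ≫ MonObj.mul ▷ M ≫ MonObj.mul := by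
    rw [← tensorHom_id, tensorHom_comp_tensorHom_assoc, Category.comp_id]; rfl
  have h2 : conv f (conv g h) = (f ⊗ₘ (g ⊗ₘ h)) ≫ M ◁ MonObj.mul ≫ MonObj.mul := by
    rw [← id_tensorHom, tensorHom_comp_tensorHom_assoc, Category.comp_id]; rfl
  rw [h1, h2, MonObj.mul_assoc, ← associator_naturality_assoc]

lemma comp_conv {X' Y' : D} (a : X' ⟶ X) (b : Y' ⟶ Y) (f : X ⟶ M) (g : Y ⟶ M) :
    conv (a ≫ f) (b ≫ g) = (a ⊗ₘ b) ≫ conv f g := by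
  simp [conv]

lemma whiskerRight_conv {X' : D} (a : X' ⟶ X) (f : X ⟶ M) (g : Y ⟶ M) :
    conv (a ≫ f) g = a ▷ Y ≫ conv f g := by
  simp [conv, MonoidalCategory.tensorHom_def]

lemma whiskerLeft_conv {Y' : D} (b : Y' ⟶ Y) (f : X ⟶ M) (g : Y ⟶ M) :
    conv f (b ≫ g) = X ◁ b ≫ conv f g := by
  simp [conv, MonoidalCategory.tensorHom_def']

lemma conv_comp {h : M ⟶ N} (hh : IsMul h) (f : X ⟶ M) (g : Y ⟶ M) :
    conv f g ≫ h = conv (f ≫ h) (g ≫ h) := by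
  unfold IsMul at hh
  simp [conv, hh]

lemma comp_rAct (a : Y ⟶ X) (f : X ⟶ M) (e : 𝟙_ D ⟶ M) :
    rAct (a ≫ f) e = a ≫ rAct f e := by
  simp [rAct, whiskerRight_conv]

lemma comp_lAct (a : Y ⟶ X) (f : X ⟶ M) (e : 𝟙_ D ⟶ M) :
    lAct e (a ≫ f) = a ≫ lAct e f := by
  simp [lAct, whiskerLeft_conv]

lemma conv_rAct (f : X ⟶ M) (g : Y ⟶ M) (e : 𝟙_ D ⟶ M) :
    conv f (rAct g e) = rAct (conv f g) e := by
  simp [rAct, whiskerLeft_conv, conv_assoc]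

lemma lAct_conv (f : X ⟶ M) (g : Y ⟶ M) (e : 𝟙_ D ⟶ M) :
    conv (lAct e f) g = lAct e (conv f g) := by
  simp [lAct, whiskerRight_conv, conv_assoc]

lemma rAct_conv (f : X ⟶ M) (g : Y ⟶ M) (e : 𝟙_ D ⟶ M) :
    conv (rAct f e) g = conv f (lAct e g) := by
  simp [lAct, rAct, whiskerRight_conv, whiskerLeft_conv, conv_assoc]

/-- The case needed is `e = IΔη`, an idempotent element that need not be the unit. -/
lemma lAct_lAct {e : 𝟙_ D ⟶ M} (he : conv e e = (λ_ (𝟙_ D)).hom ≫ e) (f : X ⟶ M) :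
    lAct e (lAct e f) = lAct e f := by
  have h1 : lAct e e = e := by simp [lAct, he]
  have h2 : lAct e (conv e f) = conv e f := by rw [← lAct_conv, h1]
  calc lAct e (lAct e f) = (λ_ X).inv ≫ lAct e (conv e f) := comp_lAct _ _ _
    _ = lAct e f := by rw [h2]; rfl

lemma rAct_one (f : X ⟶ M) : rAct f MonObj.one = f := by
  simp [rAct, conv, MonoidalCategory.tensorHom_def]

lemma lAct_one (f : X ⟶ M) : lAct MonObj.one f = f := by
  simp [lAct, conv, MonoidalCategory.tensorHom_def']

lemma IsMul.comp {L : D} [MonObj L] {f : M ⟶ N} {g : N ⟶ L} (hf : IsMul f) (hg : IsMul g) :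
    IsMul (f ≫ g) := by
  unfold IsMul at *
  rw [← Category.assoc, hf, Category.assoc, hg]
  simp

lemma isMul_id : IsMul (𝟙 M) := by simp [IsMul]

lemma isMul_one : IsMul (MonObj.one : 𝟙_ D ⟶ M) := by
  simp [IsMul, MonoidalCategory.tensorHom_def, unitors_equal]

/-- A subobject of a monoid, closed under the multiplication and containing the unit, is a
monoid. -/
@[reducible]
def monObjOfMono {R : D} (i : R ⟶ M) [Mono i] (m : R ⊗ R ⟶ R) (u : 𝟙_ D ⟶ R)
    (hm : m ≫ i = (i ⊗ₘ i) ≫ MonObj.mul) (hu : u ≫ i = MonObj.one) : MonObj R where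
  one := u
  mul := m
  one_mul := by
    have h : u ▷ R ≫ (i ⊗ₘ i) ≫ MonObj.mul = (u ≫ i ⊗ₘ i) ≫ MonObj.mul := by
      simp [MonoidalCategory.tensorHom_def]
    rw [← cancel_mono i, Category.assoc, hm, h, hu]
    exact (Iso.inv_comp_eq _).1 (lAct_one i)
  mul_one := by
    have h : R ◁ u ≫ (i ⊗ₘ i) ≫ MonObj.mul = (i ⊗ₘ u ≫ i) ≫ MonObj.mul := by
      simp [MonoidalCategory.tensorHom_def']
    rw [← cancel_mono i, Category.assoc, hm, h, hu]
    exact (Iso.inv_comp_eq _).1 (rAct_one i)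
  mul_assoc := by
    have h := conv_assoc i i i
    unfold conv at h
    rw [← hm] at h
    have h1 : (m ≫ i ⊗ₘ i) = m ▷ R ≫ (i ⊗ₘ i) := by simp [MonoidalCategory.tensorHom_def]
    have h2 : (i ⊗ₘ m ≫ i) = R ◁ m ≫ (i ⊗ₘ i) := by simp [MonoidalCategory.tensorHom_def']
    rw [h1, h2, Category.assoc, Category.assoc, ← hm] at h
    rw [← cancel_mono i]
    simpa using h

end MonoidalGeneral

/-! ### Symmetries of the notions of duoidal category and weak bimonoid. -/

section Symmetries

variable {C : Type u} [Category.{v} C]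

/-- The reversed monoidal structure. -/
@[reducible]
def revMonoidal (m : MonoidalCategory C) : MonoidalCategory C where
  tensorObj X Y := m.tensorObj Y X
  whiskerLeft X _ _ f := m.whiskerRight f X
  whiskerRight f X := m.whiskerLeft X f
  tensorHom f g := m.tensorHom g f
  tensorHom_def f g := @MonoidalCategory.tensorHom_def' C _ m _ _ _ _ g f
  id_tensorHom_id X Y := m.id_tensorHom_id Y X
  tensorHom_comp_tensorHom f g h k := m.tensorHom_comp_tensorHom g f k h
  whiskerLeft_id X Y := m.id_whiskerRight Y X
  id_whiskerRight X Y := m.whiskerLeft_id Y X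
  tensorUnit := m.tensorUnit
  associator X Y Z := (m.associator Z Y X).symm
  leftUnitor X := m.rightUnitor X
  rightUnitor X := m.leftUnitor X
  associator_naturality f g h := m.associator_inv_naturality h g f
  leftUnitor_naturality f := m.rightUnitor_naturality f
  rightUnitor_naturality f := m.leftUnitor_naturality f
  triangle X Y := @MonoidalCategory.triangle_assoc_comp_right C _ m Y X
  pentagon W X Y Z := @MonoidalCategory.pentagon_inv C _ m Z Y X W

/-- Reversing a product inverts its associator, so the reversed and dual categories need
associativity of `ζ` in this form. -/
lemma ζ_assocB_inv [DuoidalCategory C] (X Y Z U V W : C) :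
    ((assocB X Y Z).inv ⊚ₘ (assocB U V W).inv) ≫ ζ (X ⊙ Y) Z (U ⊙ V) W ≫
      ζ X Y U V ▷ᵦ (Z ⊚ W) =
      ζ X (Y ⊙ Z) U (V ⊙ W) ≫ (X ⊚ U) ◁ᵦ ζ Y Z V W ≫ (assocB (X ⊚ U) (Y ⊚ V) (Z ⊚ W)).inv := by
  have h := ζ_assocB X Y Z U V W
  rw [← Category.assoc, ← Category.assoc, Iso.eq_comp_inv, ]
  simp only [Category.assoc]
  rw [h, ← Category.assoc, (TwoMonoidal.circ (C := C)).tensorHom_comp_tensorHom, Iso.inv_hom_id,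
    Iso.inv_hom_id, (TwoMonoidal.circ (C := C)).id_tensorHom_id, Category.id_comp]

lemma ζ_assocO_inv [DuoidalCategory C] (X Y Z W U V : C) :
    (assocO (X ⊙ Y) (Z ⊙ W) (U ⊙ V)).inv ≫ ζ X Y Z W ▷ₒ (U ⊙ V) ≫ ζ (X ⊚ Z) (Y ⊚ W) U V =
      (X ⊙ Y) ◁ₒ ζ Z W U V ≫ ζ X Y (Z ⊚ U) (W ⊚ V) ≫
        ((assocO X Z U).inv ⊙ₘ (assocO Y W V).inv) := by
  have h := ζ_assocO X Y Z W U V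
  rw [Iso.inv_comp_eq, ← Category.assoc (assocO _ _ _).hom, ← Category.assoc _ _ (_ ⊙ₘ _),
    Category.assoc (assocO _ _ _).hom, ← h, Category.assoc, Category.assoc,
    (TwoMonoidal.bul (C := C)).tensorHom_comp_tensorHom, Iso.hom_inv_id,
    Iso.hom_inv_id, (TwoMonoidal.bul (C := C)).id_tensorHom_id, Category.comp_id]

/-- Reversal of the second product. -/
@[reducible]
def revB (d : DuoidalCategory C) : DuoidalCategory C where
  circ := d.circ
  bul := revMonoidal d.bul
  δ := d.δ
  ϖ := d.ϖ
  τ := d.τ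
  ζ X Y Z W := d.ζ Y X W Z
  ζ_natural f g h k := d.ζ_natural g f k h
  τ_ϖ := d.τ_ϖ
  ϖ_τ := d.ϖ_τ
  ϖ_assoc := d.ϖ_assoc
  δ_τ_left := d.δ_τ_right
  δ_τ_right := d.δ_τ_left
  δ_coassoc := by
    have := d.δ_coassoc
    change d.δ ≫ d.δ ▷ᵦ uI C = d.δ ≫ uI C ◁ᵦ d.δ ≫ (assocB (uI C) (uI C) (uI C)).inv
    rw [← Category.assoc, this]; simp
  ζ_assocO X Y Z W U V := d.ζ_assocO Y X W Z V U
  ζ_assocB X Y Z U V W := (ζ_assocB_inv Z Y X W V U).symm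
  ζ_unit_leftO X Y := d.ζ_unit_leftO Y X
  ζ_unit_rightO X Y := d.ζ_unit_rightO Y X
  ζ_unit_leftB X Y := d.ζ_unit_rightB X Y
  ζ_unit_rightB X Y := d.ζ_unit_leftB X Y

/-- Reversal of the first product. -/
@[reducible]
def revO (d : DuoidalCategory C) : DuoidalCategory C where
  circ := revMonoidal d.circ
  bul := d.bul
  δ := d.δ
  ϖ := d.ϖ
  τ := d.τ
  ζ X Y Z W := d.ζ Z W X Y
  ζ_natural f g h k := d.ζ_natural h k f g
  τ_ϖ := d.ϖ_τ
  ϖ_τ := d.τ_ϖ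
  ϖ_assoc := by
    have := d.ϖ_assoc
    change uJ C ◁ₒ d.ϖ ≫ d.ϖ = (assocO (uJ C) (uJ C) (uJ C)).inv ≫ d.ϖ ▷ₒ uJ C ≫ d.ϖ
    rw [this]; simp
  δ_τ_left := d.δ_τ_left
  δ_τ_right := d.δ_τ_right
  δ_coassoc := d.δ_coassoc
  ζ_assocO X Y Z W U V := (ζ_assocO_inv U V Z W X Y).symm
  ζ_assocB X Y Z U V W := d.ζ_assocB U V W X Y Z
  ζ_unit_leftO X Y := d.ζ_unit_rightO X Y
  ζ_unit_rightO X Y := d.ζ_unit_leftO X Y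
  ζ_unit_leftB X Y := d.ζ_unit_leftB Y X
  ζ_unit_rightB X Y := d.ζ_unit_rightB Y X

open Opposite

/-- The opposite category, with the two products interchanged. -/
@[reducible]
def dualDuoidal (d : DuoidalCategory C) : DuoidalCategory Cᵒᵖ where
  circ := @monoidalCategoryOp C _ d.bul
  bul := @monoidalCategoryOp C _ d.circ
  δ := d.ϖ.op
  ϖ := d.δ.op
  τ := d.τ.op
  ζ X Y Z W := (d.ζ X.unop Z.unop Y.unop W.unop).op
  ζ_natural f g h k := Quiver.Hom.unop_inj (d.ζ_natural f.unop h.unop g.unop k.unop).symm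
  τ_ϖ := Quiver.Hom.unop_inj d.δ_τ_left
  ϖ_τ := Quiver.Hom.unop_inj d.δ_τ_right
  ϖ_assoc := Quiver.Hom.unop_inj (by
    have := d.δ_coassoc
    change d.δ ≫ d.δ ▷ᵦ uI C = (d.δ ≫ uI C ◁ᵦ d.δ) ≫ (assocB (uI C) (uI C) (uI C)).inv
    rw [this]; simp)
  δ_τ_left := Quiver.Hom.unop_inj d.τ_ϖ
  δ_τ_right := Quiver.Hom.unop_inj d.ϖ_τ
  δ_coassoc := Quiver.Hom.unop_inj (by
    have := d.ϖ_assoc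
    change uJ C ◁ₒ d.ϖ ≫ d.ϖ = ((assocO (uJ C) (uJ C) (uJ C)).inv ≫ d.ϖ ▷ₒ uJ C) ≫ d.ϖ
    rw [Category.assoc, this]; simp)
  ζ_assocO X Y Z W U V := Quiver.Hom.unop_inj
    ((Category.assoc _ _ _).trans ((ζ_assocB_inv X.unop Z.unop U.unop Y.unop W.unop V.unop).trans
      (Category.assoc _ _ _).symm))
  ζ_assocB X Y Z U V W := Quiver.Hom.unop_inj
    ((Category.assoc _ _ _).trans ((ζ_assocO_inv X.unop U.unop Y.unop V.unop Z.unop W.unop).trans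
      (Category.assoc _ _ _).symm))
  ζ_unit_leftO X Y := Quiver.Hom.unop_inj (((Category.assoc _ _ _).trans
    (Category.assoc _ _ _)).trans (d.ζ_unit_leftB X.unop Y.unop))
  ζ_unit_rightO X Y := Quiver.Hom.unop_inj (((Category.assoc _ _ _).trans
    (Category.assoc _ _ _)).trans (d.ζ_unit_rightB X.unop Y.unop))
  ζ_unit_leftB X Y := Quiver.Hom.unop_inj (((Category.assoc _ _ _).trans
    (Category.assoc _ _ _)).trans (d.ζ_unit_leftO X.unop Y.unop))
  ζ_unit_rightB X Y := Quiver.Hom.unop_inj (((Category.assoc _ _ _).trans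
    (Category.assoc _ _ _)).trans (d.ζ_unit_rightO X.unop Y.unop))

section MonComonSymmetries

/-- The data of `A` after reversal of the second product. -/
@[reducible]
def revBMonComon [d : DuoidalCategory C] (A : C) [MonComon A] :
    @MonComon C _ (revB d) A :=
  @MonComon.mk C _ (revB d) A (MonComon.monObj (A := A))
    (@ComonObj.mk C _ (revB d).bul A (εA A) (ΔA A) (MonComon.comonObj (A := A)).comul_counit
      (MonComon.comonObj (A := A)).counit_comul (by
        have h' : ΔA A ≫ A ◁ᵦ ΔA A = ΔA A ≫ ΔA A ▷ᵦ A ≫ (assocB A A A).hom :=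
          (MonComon.comonObj (A := A)).comul_assoc
        change ΔA A ≫ ΔA A ▷ᵦ A = ΔA A ≫ A ◁ᵦ ΔA A ≫ (assocB A A A).inv
        rw [← Category.assoc, h']; simp))

/-- The data of `A` after reversal of the first product. -/
@[reducible]
def revOMonComon [d : DuoidalCategory C] (A : C) [MonComon A] :
    @MonComon C _ (revO d) A :=
  @MonComon.mk C _ (revO d) A
    (@MonObj.mk C _ (revO d).circ A (ηA A) (μA A) (MonComon.monObj (A := A)).mul_one
      (MonComon.monObj (A := A)).one_mul (by
        have h' : μA A ▷ₒ A ≫ μA A = (assocO A A A).hom ≫ A ◁ₒ μA A ≫ μA A :=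
          (MonComon.monObj (A := A)).mul_assoc
        change A ◁ₒ μA A ≫ μA A = (assocO A A A).inv ≫ μA A ▷ₒ A ≫ μA A
        rw [h']; simp))
    (MonComon.comonObj (A := A))

/-- The data of `A` in the dual duoidal category. -/
@[reducible]
def dualMonComon [d : DuoidalCategory C] (A : C) [MonComon A] :
    @MonComon Cᵒᵖ _ (dualDuoidal d) (op A) :=
  @MonComon.mk Cᵒᵖ _ (dualDuoidal d) (op A)
    (@MonObj.mk Cᵒᵖ _ (dualDuoidal d).circ (op A) (εA A).op (ΔA A).op
      (Quiver.Hom.unop_inj (MonComon.comonObj (A := A)).counit_comul)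
      (Quiver.Hom.unop_inj (MonComon.comonObj (A := A)).comul_counit)
      (Quiver.Hom.unop_inj (by
        have h' : ΔA A ≫ A ◁ᵦ ΔA A = ΔA A ≫ ΔA A ▷ᵦ A ≫ (assocB A A A).hom :=
          (MonComon.comonObj (A := A)).comul_assoc
        change ΔA A ≫ ΔA A ▷ᵦ A = (ΔA A ≫ A ◁ᵦ ΔA A) ≫ (assocB A A A).inv
        rw [h']; simp)))
    (@ComonObj.mk Cᵒᵖ _ (dualDuoidal d).bul (op A) (ηA A).op (μA A).op
      (Quiver.Hom.unop_inj (MonComon.monObj (A := A)).one_mul)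
      (Quiver.Hom.unop_inj (MonComon.monObj (A := A)).mul_one)
      (Quiver.Hom.unop_inj (by
        have h' : μA A ▷ₒ A ≫ μA A = (assocO A A A).hom ≫ A ◁ₒ μA A ≫ μA A :=
          (MonComon.monObj (A := A)).mul_assoc
        change A ◁ₒ μA A ≫ μA A = ((assocO A A A).inv ≫ μA A ▷ₒ A) ≫ μA A
        rw [Category.assoc, h']; simp)))

variable [d : DuoidalCategory C] (A : C) [MonComon A]

/-- Reversing `•` exchanges RRU with LRU, RLU with LLU, LLC with LRC and RLC with RRC, in each case
by definition. -/
lemma IsWeakBimonoid.revB {A : C} [MonComon A] (h : IsWeakBimonoid A) :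
    @IsWeakBimonoid C _ (revB d) A (revBMonComon A) :=
  @IsWeakBimonoid.mk C _ (Duoidal.revB d) A (revBMonComon A)
   (@IsRightWeakBimonoid.mk C _ (Duoidal.revB d) A (revBMonComon A)
     h.right.wb h.right.lru h.right.rru h.right.llc h.right.lrc)
   (@IsLeftWeakBimonoid.mk C _ (Duoidal.revB d) A (revBMonComon A)
     h.left.wb h.left.llu h.left.rlu h.left.rrc h.left.rlc)

/-- Reversing `∘` exchanges RRU with RLU, LRU with LLU, LLC with RLC and LRC with RRC. -/
lemma IsWeakBimonoid.revO {A : C} [MonComon A] (h : IsWeakBimonoid A) :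
    @IsWeakBimonoid C _ (revO d) A (revOMonComon A) :=
  @IsWeakBimonoid.mk C _ (Duoidal.revO d) A (revOMonComon A)
   (@IsRightWeakBimonoid.mk C _ (Duoidal.revO d) A (revOMonComon A)
     h.left.wb h.left.rlu h.left.llu h.left.rrc h.left.rlc)
   (@IsLeftWeakBimonoid.mk C _ (Duoidal.revO d) A (revOMonComon A)
     h.right.wb h.right.rru h.right.lru h.right.llc h.right.lrc)

variable {A}

lemma AxWB.dual (h : AxWB A) : @AxWB Cᵒᵖ _ (dualDuoidal d) (op A) (dualMonComon A) :=
  Quiver.Hom.unop_inj (Eq.trans h (Category.assoc _ _ _).symm)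

lemma AxRLU.dual (h : AxRLU A) : @AxLRC Cᵒᵖ _ (dualDuoidal d) (op A) (dualMonComon A) := by
  refine Quiver.Hom.unop_inj ?_
  -- Taking opposites brackets composites to the left, so the dual axiom agrees with the original
  -- one only up to reassociation. The same device recurs for the other duals.
  change ((((δ ≫ uI C ◁ᵦ Δη A) ≫ (assocB (uI C) A A).inv) ≫
    (((((lunitO (uI C ⊙ A)).inv ≫ ((δ ≫ uI C ◁ᵦ Δη A) ≫ (assocB (uI C) A A).inv) ▷ₒ (uI C ⊙ A)) ≫
      ζ (uI C ⊙ A) A (uI C) A) ≫ (runitO (uI C ⊙ A)).hom ▷ᵦ (A ⊚ A)) ≫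
        (uI C ⊙ A) ◁ᵦ μA A) ▷ᵦ A) ≫ (assocB (uI C ⊙ A) A A).hom) ≫
          (assocB (uI C) A (A ⊙ A)).hom =
    ((δ ≫ uI C ◁ᵦ ηA A) ≫ uI C ◁ᵦ ΔA A) ≫ uI C ◁ᵦ (A ◁ᵦ ΔA A)
  simpa only [AxRLU, unitR, IΔη, Category.assoc] using h

lemma AxRRU.dual (h : AxRRU A) : @AxLLC Cᵒᵖ _ (dualDuoidal d) (op A) (dualMonComon A) := by
  refine Quiver.Hom.unop_inj ?_
  change ((((δ ≫ uI C ◁ᵦ Δη A) ≫ (assocB (uI C) A A).inv) ≫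
    (((((runitO (uI C ⊙ A)).inv ≫ (uI C ⊙ A) ◁ₒ ((δ ≫ uI C ◁ᵦ Δη A) ≫ (assocB (uI C) A A).inv)) ≫
      ζ (uI C) A (uI C ⊙ A) A) ≫ (lunitO (uI C ⊙ A)).hom ▷ᵦ (A ⊚ A)) ≫
        (uI C ⊙ A) ◁ᵦ μA A) ▷ᵦ A) ≫ (assocB (uI C ⊙ A) A A).hom) ≫
          (assocB (uI C) A (A ⊙ A)).hom =
    ((δ ≫ uI C ◁ᵦ ηA A) ≫ uI C ◁ᵦ ΔA A) ≫ uI C ◁ᵦ (A ◁ᵦ ΔA A)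
  simpa only [AxRRU, unitR, IΔη, Category.assoc] using h

lemma AxLLC.dual (h : AxLLC A) : @AxRRU Cᵒᵖ _ (dualDuoidal d) (op A) (dualMonComon A) := by
  refine Quiver.Hom.unop_inj ?_
  change (((assocO (uJ C) A (A ⊚ A)).inv ≫ (assocO (uJ C ⊚ A) A A).inv) ≫
    (((((uJ C ⊚ A) ◁ₒ ΔA A ≫ (lunitB (uJ C ⊚ A)).inv ▷ₒ (A ⊙ A)) ≫ ζ (uJ C) (uJ C ⊚ A) A A) ≫
      (uJ C ⊚ A) ◁ᵦ (((assocO (uJ C) A A).hom ≫ uJ C ◁ₒ εμ A) ≫ ϖ)) ≫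
        (runitB (uJ C ⊚ A)).hom) ▷ₒ A) ≫ (((assocO (uJ C) A A).hom ≫ uJ C ◁ₒ εμ A) ≫ ϖ) =
    ((uJ C ◁ₒ (A ◁ₒ μA A) ≫ uJ C ◁ₒ μA A) ≫ uJ C ◁ₒ εA A) ≫ ϖ
  simpa only [AxLLC, counitL, Jεμ, Category.assoc] using h

lemma AxLRC.dual (h : AxLRC A) : @AxRLU Cᵒᵖ _ (dualDuoidal d) (op A) (dualMonComon A) := by
  refine Quiver.Hom.unop_inj ?_
  change (((assocO (uJ C) A (A ⊚ A)).inv ≫ (assocO (uJ C ⊚ A) A A).inv) ≫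
    (((((uJ C ⊚ A) ◁ₒ ΔA A ≫ (runitB (uJ C ⊚ A)).inv ▷ₒ (A ⊙ A)) ≫ ζ (uJ C ⊚ A) (uJ C) A A) ≫
      (((assocO (uJ C) A A).hom ≫ uJ C ◁ₒ εμ A) ≫ ϖ) ▷ᵦ (uJ C ⊚ A)) ≫
        (lunitB (uJ C ⊚ A)).hom) ▷ₒ A) ≫ (((assocO (uJ C) A A).hom ≫ uJ C ◁ₒ εμ A) ≫ ϖ) =
    ((uJ C ◁ₒ (A ◁ₒ μA A) ≫ uJ C ◁ₒ μA A) ≫ uJ C ◁ₒ εA A) ≫ ϖ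
  simpa only [AxLRC, counitL, Jεμ, Category.assoc] using h

lemma IsWeakBimonoid.dual (h : IsWeakBimonoid A) :
    @IsWeakBimonoid Cᵒᵖ _ (dualDuoidal d) (op A) (dualMonComon A) :=
  let A' := revBMonComon A
  let A'' := revOMonComon A
  @IsWeakBimonoid.mk Cᵒᵖ _ (dualDuoidal d) (op A) (dualMonComon A)
   -- Duality exchanges LLC with RRU and LRC with RLU. The other four conditions are reached by
   -- reversing one product first: for example RLC is LLC after reversing `∘`, and it becomes LRU
   -- because the dual then has `•` reversed.
   (@IsRightWeakBimonoid.mk Cᵒᵖ _ (dualDuoidal d) (op A) (dualMonComon A)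
     h.right.wb.dual h.right.llc.dual
      (@AxLLC.dual C _ (Duoidal.revO d) A A'' h.left.rlc) h.left.rlu.dual h.right.rru.dual)
   (@IsLeftWeakBimonoid.mk Cᵒᵖ _ (dualDuoidal d) (op A) (dualMonComon A)
     h.right.wb.dual h.right.lrc.dual
      (@AxLRC.dual C _ (Duoidal.revO d) A A'' h.left.rrc)
      (@AxRRU.dual C _ (Duoidal.revB d) A A' h.right.lru)
      (@AxRLU.dual C _ (Duoidal.revB d) A A' h.left.llu))

end MonComonSymmetries

end Symmetries

/-! ### Monoidal coherence identities, named separately for the two products. -/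

section WhiskerLemmas

variable {C : Type u} [Category.{v} C] [TwoMonoidal C]

namespace Circ

lemma whiskerLeft_comp (W : C) {X Y Z : C} (f : X ⟶ Y) (g : Y ⟶ Z) :
    W ◁ₒ (f ≫ g) = W ◁ₒ f ≫ W ◁ₒ g :=
  @MonoidalCategory.whiskerLeft_comp C _ TwoMonoidal.circ W X Y Z f g

lemma comp_whiskerRight {W X Y : C} (f : W ⟶ X) (g : X ⟶ Y) (Z : C) :
    (f ≫ g) ▷ₒ Z = f ▷ₒ Z ≫ g ▷ₒ Z :=
  @MonoidalCategory.comp_whiskerRight C _ TwoMonoidal.circ W X Y f g Z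

lemma id_whiskerRight (X Y : C) : 𝟙 X ▷ₒ Y = 𝟙 (X ⊚ Y) :=
  @MonoidalCategory.id_whiskerRight C _ TwoMonoidal.circ X Y

lemma whiskerLeft_id (X Y : C) : X ◁ₒ 𝟙 Y = 𝟙 (X ⊚ Y) :=
  @MonoidalCategory.whiskerLeft_id C _ TwoMonoidal.circ X Y

lemma whisker_exchange {W X Y Z : C} (f : W ⟶ X) (g : Y ⟶ Z) :
    W ◁ₒ g ≫ f ▷ₒ Z = f ▷ₒ Y ≫ X ◁ₒ g :=
  @MonoidalCategory.whisker_exchange C _ TwoMonoidal.circ W X Y Z f g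

lemma tensorHom_def {W X Y Z : C} (f : W ⟶ X) (g : Y ⟶ Z) :
    (f ⊚ₘ g) = f ▷ₒ Y ≫ X ◁ₒ g :=
  @MonoidalCategory.tensorHom_def C _ TwoMonoidal.circ W X Y Z f g

lemma tensorHom_comp_tensorHom {X₁ X₂ X₃ Y₁ Y₂ Y₃ : C} (f : X₁ ⟶ X₂) (g : Y₁ ⟶ Y₂)
    (h : X₂ ⟶ X₃) (k : Y₂ ⟶ Y₃) : (f ⊚ₘ g) ≫ (h ⊚ₘ k) = (f ≫ h) ⊚ₘ (g ≫ k) :=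
  @MonoidalCategory.tensorHom_comp_tensorHom C _ TwoMonoidal.circ _ _ _ _ _ _ f g h k

lemma id_tensorHom (X : C) {Y Z : C} (f : Y ⟶ Z) : (𝟙 X ⊚ₘ f) = X ◁ₒ f :=
  @MonoidalCategory.id_tensorHom C _ TwoMonoidal.circ X Y Z f

lemma tensorHom_id {Y Z : C} (f : Y ⟶ Z) (X : C) : (f ⊚ₘ 𝟙 X) = f ▷ₒ X :=
  @MonoidalCategory.tensorHom_id C _ TwoMonoidal.circ Y Z f X

lemma rightUnitor_naturality {X Y : C} (f : X ⟶ Y) :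
    f ▷ₒ uI C ≫ (runitO Y).hom = (runitO X).hom ≫ f :=
  @MonoidalCategory.rightUnitor_naturality C _ TwoMonoidal.circ X Y f

lemma leftUnitor_naturality {X Y : C} (f : X ⟶ Y) :
    uI C ◁ₒ f ≫ (lunitO Y).hom = (lunitO X).hom ≫ f :=
  @MonoidalCategory.leftUnitor_naturality C _ TwoMonoidal.circ X Y f

lemma rightUnitor_inv_naturality {X Y : C} (f : X ⟶ Y) :
    f ≫ (runitO Y).inv = (runitO X).inv ≫ f ▷ₒ uI C :=
  @MonoidalCategory.rightUnitor_inv_naturality C _ TwoMonoidal.circ X Y f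

lemma associator_naturality_left {X X' : C} (f : X ⟶ X') (Y Z : C) :
    (f ▷ₒ Y) ▷ₒ Z ≫ (assocO X' Y Z).hom = (assocO X Y Z).hom ≫ f ▷ₒ (Y ⊚ Z) :=
  @MonoidalCategory.associator_naturality_left C _ TwoMonoidal.circ X X' f Y Z

lemma associator_naturality_middle (X : C) {Y Y' : C} (f : Y ⟶ Y') (Z : C) :
    (X ◁ₒ f) ▷ₒ Z ≫ (assocO X Y' Z).hom = (assocO X Y Z).hom ≫ X ◁ₒ (f ▷ₒ Z) :=
  @MonoidalCategory.associator_naturality_middle C _ TwoMonoidal.circ X Y Y' f Z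

lemma associator_naturality_right (X Y : C) {Z Z' : C} (f : Z ⟶ Z') :
    (X ⊚ Y) ◁ₒ f ≫ (assocO X Y Z').hom = (assocO X Y Z).hom ≫ X ◁ₒ (Y ◁ₒ f) :=
  @MonoidalCategory.associator_naturality_right C _ TwoMonoidal.circ X Y Z Z' f

lemma associator_inv_naturality_right (X Y : C) {Z Z' : C} (f : Z ⟶ Z') :
    X ◁ₒ (Y ◁ₒ f) ≫ (assocO X Y Z').inv = (assocO X Y Z).inv ≫ (X ⊚ Y) ◁ₒ f :=
  @MonoidalCategory.associator_inv_naturality_right C _ TwoMonoidal.circ X Y Z Z' f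

lemma pentagon (W X Y Z : C) :
    (assocO W X Y).hom ▷ₒ Z ≫ (assocO W (X ⊚ Y) Z).hom ≫ W ◁ₒ (assocO X Y Z).hom =
      (assocO (W ⊚ X) Y Z).hom ≫ (assocO W X (Y ⊚ Z)).hom :=
  @MonoidalCategory.pentagon C _ TwoMonoidal.circ W X Y Z

lemma pentagon_inv_hom (W X Y Z : C) :
    (assocO W X Y).inv ▷ₒ Z ≫ (assocO (W ⊚ X) Y Z).hom ≫ (assocO W X (Y ⊚ Z)).hom =
      (assocO W (X ⊚ Y) Z).hom ≫ W ◁ₒ (assocO X Y Z).hom :=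
  @MonoidalCategory.pentagon_inv_hom_hom_hom_hom C _ TwoMonoidal.circ W X Y Z

lemma triangle_inv (X Y : C) :
    (assocO X (uI C) Y).inv ≫ (runitO X).hom ▷ₒ Y = X ◁ₒ (lunitO Y).hom :=
  @MonoidalCategory.triangle_assoc_comp_right C _ TwoMonoidal.circ X Y

lemma triangle (X Y : C) :
    (assocO X (uI C) Y).hom ≫ X ◁ₒ (lunitO Y).hom = (runitO X).hom ▷ₒ Y :=
  @MonoidalCategory.triangle C _ TwoMonoidal.circ X Y

end Circ

namespace Bul

lemma whiskerLeft_comp (W : C) {X Y Z : C} (f : X ⟶ Y) (g : Y ⟶ Z) :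
    W ◁ᵦ (f ≫ g) = W ◁ᵦ f ≫ W ◁ᵦ g :=
  @MonoidalCategory.whiskerLeft_comp C _ TwoMonoidal.bul W X Y Z f g

lemma comp_whiskerRight {W X Y : C} (f : W ⟶ X) (g : X ⟶ Y) (Z : C) :
    (f ≫ g) ▷ᵦ Z = f ▷ᵦ Z ≫ g ▷ᵦ Z :=
  @MonoidalCategory.comp_whiskerRight C _ TwoMonoidal.bul W X Y f g Z

lemma id_whiskerRight (X Y : C) : 𝟙 X ▷ᵦ Y = 𝟙 (X ⊙ Y) :=
  @MonoidalCategory.id_whiskerRight C _ TwoMonoidal.bul X Y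

lemma whiskerLeft_id (X Y : C) : X ◁ᵦ 𝟙 Y = 𝟙 (X ⊙ Y) :=
  @MonoidalCategory.whiskerLeft_id C _ TwoMonoidal.bul X Y

lemma whisker_exchange {W X Y Z : C} (f : W ⟶ X) (g : Y ⟶ Z) :
    W ◁ᵦ g ≫ f ▷ᵦ Z = f ▷ᵦ Y ≫ X ◁ᵦ g :=
  @MonoidalCategory.whisker_exchange C _ TwoMonoidal.bul W X Y Z f g

lemma tensorHom_def {W X Y Z : C} (f : W ⟶ X) (g : Y ⟶ Z) :
    (f ⊙ₘ g) = f ▷ᵦ Y ≫ X ◁ᵦ g :=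
  @MonoidalCategory.tensorHom_def C _ TwoMonoidal.bul W X Y Z f g

lemma tensorHom_comp_tensorHom {X₁ X₂ X₃ Y₁ Y₂ Y₃ : C} (f : X₁ ⟶ X₂) (g : Y₁ ⟶ Y₂)
    (h : X₂ ⟶ X₃) (k : Y₂ ⟶ Y₃) : (f ⊙ₘ g) ≫ (h ⊙ₘ k) = (f ≫ h) ⊙ₘ (g ≫ k) :=
  @MonoidalCategory.tensorHom_comp_tensorHom C _ TwoMonoidal.bul _ _ _ _ _ _ f g h k

lemma id_tensorHom (X : C) {Y Z : C} (f : Y ⟶ Z) : (𝟙 X ⊙ₘ f) = X ◁ᵦ f :=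
  @MonoidalCategory.id_tensorHom C _ TwoMonoidal.bul X Y Z f

lemma tensorHom_id {Y Z : C} (f : Y ⟶ Z) (X : C) : (f ⊙ₘ 𝟙 X) = f ▷ᵦ X :=
  @MonoidalCategory.tensorHom_id C _ TwoMonoidal.bul Y Z f X

lemma rightUnitor_naturality {X Y : C} (f : X ⟶ Y) :
    f ▷ᵦ uJ C ≫ (runitB Y).hom = (runitB X).hom ≫ f :=
  @MonoidalCategory.rightUnitor_naturality C _ TwoMonoidal.bul X Y f

lemma leftUnitor_naturality {X Y : C} (f : X ⟶ Y) :
    uJ C ◁ᵦ f ≫ (lunitB Y).hom = (lunitB X).hom ≫ f :=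
  @MonoidalCategory.leftUnitor_naturality C _ TwoMonoidal.bul X Y f

lemma leftUnitor_inv_naturality {X Y : C} (f : X ⟶ Y) :
    f ≫ (lunitB Y).inv = (lunitB X).inv ≫ uJ C ◁ᵦ f :=
  @MonoidalCategory.leftUnitor_inv_naturality C _ TwoMonoidal.bul X Y f

lemma associator_inv_naturality_left {X X' : C} (f : X ⟶ X') (Y Z : C) :
    f ▷ᵦ (Y ⊙ Z) ≫ (assocB X' Y Z).inv = (assocB X Y Z).inv ≫ (f ▷ᵦ Y) ▷ᵦ Z :=
  @MonoidalCategory.associator_inv_naturality_left C _ TwoMonoidal.bul X X' f Y Z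

lemma associator_inv_naturality_middle (X : C) {Y Y' : C} (f : Y ⟶ Y') (Z : C) :
    X ◁ᵦ (f ▷ᵦ Z) ≫ (assocB X Y' Z).inv = (assocB X Y Z).inv ≫ (X ◁ᵦ f) ▷ᵦ Z :=
  @MonoidalCategory.associator_inv_naturality_middle C _ TwoMonoidal.bul X Y Y' f Z

lemma associator_inv_naturality_right (X Y : C) {Z Z' : C} (f : Z ⟶ Z') :
    X ◁ᵦ (Y ◁ᵦ f) ≫ (assocB X Y Z').inv = (assocB X Y Z).inv ≫ (X ⊙ Y) ◁ᵦ f :=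
  @MonoidalCategory.associator_inv_naturality_right C _ TwoMonoidal.bul X Y Z Z' f

lemma associator_inv_naturality {X X' Y Y' Z Z' : C} (f : X ⟶ X') (g : Y ⟶ Y') (h : Z ⟶ Z') :
    (f ⊙ₘ (g ⊙ₘ h)) ≫ (assocB X' Y' Z').inv = (assocB X Y Z).inv ≫ ((f ⊙ₘ g) ⊙ₘ h) :=
  @MonoidalCategory.associator_inv_naturality C _ TwoMonoidal.bul _ _ _ _ _ _ f g h

lemma pentagon_inv_hom (W X Y Z : C) :
    (assocB W X Y).inv ▷ᵦ Z ≫ (assocB (W ⊙ X) Y Z).hom ≫ (assocB W X (Y ⊙ Z)).hom =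
      (assocB W (X ⊙ Y) Z).hom ≫ W ◁ᵦ (assocB X Y Z).hom :=
  @MonoidalCategory.pentagon_inv_hom_hom_hom_hom C _ TwoMonoidal.bul W X Y Z

lemma triangle_inv (X Y : C) :
    (assocB X (uJ C) Y).inv ≫ (runitB X).hom ▷ᵦ Y = X ◁ᵦ (lunitB Y).hom :=
  @MonoidalCategory.triangle_assoc_comp_right C _ TwoMonoidal.bul X Y

lemma leftUnitor_tensor (X Y : C) :
    (lunitB (X ⊙ Y)).hom = (assocB (uJ C) X Y).inv ≫ (lunitB X).hom ▷ᵦ Y :=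
  @MonoidalCategory.leftUnitor_tensor_hom C _ TwoMonoidal.bul X Y

lemma unitors_equal : (lunitB (uJ C)).hom = (runitB (uJ C)).hom :=
  @MonoidalCategory.unitors_equal C _ TwoMonoidal.bul

end Bul

end WhiskerLemmas

-- From here on `conv`, `IsMul` and `MonObj` refer to the product `∘`.
attribute [local instance] TwoMonoidal.circ

/-! ### The interchange law and `•`-products of `∘`-monoids. -/

section Interchange

variable {C : Type u} [Category.{v} C] [DuoidalCategory C]

lemma ζ_natural₁ {X X' : C} (f : X ⟶ X') (Y Z W : C) :
    (f ▷ᵦ Y) ▷ₒ (Z ⊙ W) ≫ ζ X' Y Z W = ζ X Y Z W ≫ (f ▷ₒ Z) ▷ᵦ (Y ⊚ W) := by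
  have h := ζ_natural f (𝟙 Y) (𝟙 Z) (𝟙 W)
  simpa only [Bul.tensorHom_id, Bul.id_whiskerRight, Circ.tensorHom_id,
    Circ.id_whiskerRight] using h

lemma ζ_natural₂ (X : C) {Y Y' : C} (f : Y ⟶ Y') (Z W : C) :
    (X ◁ᵦ f) ▷ₒ (Z ⊙ W) ≫ ζ X Y' Z W = ζ X Y Z W ≫ (X ⊚ Z) ◁ᵦ (f ▷ₒ W) := by
  have h := ζ_natural (𝟙 X) f (𝟙 Z) (𝟙 W)
  simpa only [Bul.tensorHom_id, Bul.id_tensorHom, Bul.id_whiskerRight, Circ.tensorHom_id,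
    Circ.id_whiskerRight] using h

lemma ζ_natural₃ (X Y : C) {Z Z' : C} (f : Z ⟶ Z') (W : C) :
    (X ⊙ Y) ◁ₒ (f ▷ᵦ W) ≫ ζ X Y Z' W = ζ X Y Z W ≫ (X ◁ₒ f) ▷ᵦ (Y ⊚ W) := by
  have h := ζ_natural (𝟙 X) (𝟙 Y) f (𝟙 W)
  simpa only [Bul.tensorHom_id, Bul.id_whiskerRight, Circ.id_tensorHom,
    Circ.whiskerLeft_id] using h

/-- The multiplication of a monoid for the first product. -/
abbrev mO (X : C) [MonObj X] : X ⊚ X ⟶ X := MonObj.mul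

/-- The unit of a monoid for the first product. -/
abbrev oO (X : C) [MonObj X] : uI C ⟶ X := MonObj.one

lemma oO_mul (X : C) [MonObj X] : oO X ▷ₒ X ≫ mO X = (lunitO X).hom := MonObj.one_mul X

lemma mO_one (X : C) [MonObj X] : X ◁ₒ oO X ≫ mO X = (runitO X).hom := MonObj.mul_one X

lemma mO_assoc (X : C) [MonObj X] :
    mO X ▷ₒ X ≫ mO X = (assocO X X X).hom ≫ X ◁ₒ mO X ≫ mO X := MonObj.mul_assoc X

/-- The second product of two monoids is a monoid. -/
instance bulMonObj (X Y : C) [MonObj X] [MonObj Y] : MonObj (X ⊙ Y) where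
  one := δ ≫ (oO X ⊙ₘ oO Y)
  mul := ζ X Y X Y ≫ (mO X ⊙ₘ mO Y)
  one_mul := by
    change (δ ≫ (oO X ⊙ₘ oO Y)) ▷ₒ (X ⊙ Y) ≫ ζ X Y X Y ≫ (mO X ⊙ₘ mO Y) = (lunitO (X ⊙ Y)).hom
    have h := ζ_unit_leftO X Y
    have h2 := ζ_natural (oO X) (oO Y) (𝟙 X) (𝟙 Y)
    rw [Bul.id_tensorHom, Bul.whiskerLeft_id, Circ.tensorHom_id] at h2
    rw [Iso.inv_comp_eq, Category.comp_id] at h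
    rw [← h, Circ.comp_whiskerRight, Category.assoc, reassoc_of% h2,
      Bul.tensorHom_comp_tensorHom, Circ.tensorHom_id, Circ.tensorHom_id, oO_mul, oO_mul]
  mul_one := by
    change (X ⊙ Y) ◁ₒ (δ ≫ (oO X ⊙ₘ oO Y)) ≫ ζ X Y X Y ≫ (mO X ⊙ₘ mO Y) = (runitO (X ⊙ Y)).hom
    have h := ζ_unit_rightO X Y
    have h2 := ζ_natural (𝟙 X) (𝟙 Y) (oO X) (oO Y)
    rw [Bul.id_tensorHom, Bul.whiskerLeft_id, Circ.id_tensorHom] at h2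
    rw [Iso.inv_comp_eq, Category.comp_id] at h
    rw [← h, Circ.whiskerLeft_comp, Category.assoc, reassoc_of% h2,
      Bul.tensorHom_comp_tensorHom, Circ.id_tensorHom, Circ.id_tensorHom, mO_one, mO_one]
  mul_assoc := by
    change (ζ X Y X Y ≫ (mO X ⊙ₘ mO Y)) ▷ₒ (X ⊙ Y) ≫ ζ X Y X Y ≫ (mO X ⊙ₘ mO Y) =
      (assocO (X ⊙ Y) (X ⊙ Y) (X ⊙ Y)).hom ≫
        (X ⊙ Y) ◁ₒ (ζ X Y X Y ≫ (mO X ⊙ₘ mO Y)) ≫ ζ X Y X Y ≫ (mO X ⊙ₘ mO Y)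
    have h := ζ_assocO X Y X Y X Y
    have h2 := ζ_natural (mO X) (mO Y) (𝟙 X) (𝟙 Y)
    have h3 := ζ_natural (𝟙 X) (𝟙 Y) (mO X) (mO Y)
    rw [Bul.id_tensorHom, Bul.whiskerLeft_id, Circ.tensorHom_id] at h2
    rw [Bul.id_tensorHom, Bul.whiskerLeft_id, Circ.id_tensorHom] at h3
    rw [Circ.comp_whiskerRight, Circ.whiskerLeft_comp, Category.assoc, Category.assoc,
      reassoc_of% h2, reassoc_of% h3, ← reassoc_of% h, Bul.tensorHom_comp_tensorHom,
      Bul.tensorHom_comp_tensorHom, Bul.tensorHom_comp_tensorHom]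
    simp only [Circ.tensorHom_id, Circ.id_tensorHom, mO_assoc]

variable {X X' Y Y' Z : C} [MonObj X] [MonObj X'] [MonObj Y] [MonObj Y'] [MonObj Z]

lemma mO_bul : mO (X ⊙ Y) = ζ X Y X Y ≫ (mO X ⊙ₘ mO Y) := rfl

lemma oO_bul : oO (X ⊙ Y) = δ ≫ (oO X ⊙ₘ oO Y) := rfl

lemma isMul_iff {f : X ⟶ X'} : IsMul f ↔ mO X ≫ f = (f ⊚ₘ f) ≫ mO X' := Iff.rfl

lemma IsMul.bul {f : X ⟶ X'} {g : Y ⟶ Y'} (hf : IsMul f) (hg : IsMul g) : IsMul (f ⊙ₘ g) := by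
  rw [isMul_iff] at *
  rw [mO_bul, mO_bul, reassoc_of% (ζ_natural f g f g), Category.assoc,
    Bul.tensorHom_comp_tensorHom, Bul.tensorHom_comp_tensorHom, hf, hg]

/-- This is the `•`-associativity of `ζ`, combined with naturality of the associator in the three
multiplications. -/
lemma isMul_assocB_inv : IsMul (assocB X Y Z).inv := by
  have h := ζ_assocB_inv X Y Z X Y Z
  have h2 := Bul.associator_inv_naturality (mO X) (mO Y) (mO Z)
  rw [isMul_iff]
  calc mO (X ⊙ (Y ⊙ Z)) ≫ (assocB X Y Z).inv
      = (ζ X (Y ⊙ Z) X (Y ⊙ Z) ≫ (X ⊚ X) ◁ᵦ ζ Y Z Y Z ≫ (mO X ⊙ₘ (mO Y ⊙ₘ mO Z))) ≫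
          (assocB X Y Z).inv := by
        rw [mO_bul, mO_bul, ← Bul.id_tensorHom, Bul.tensorHom_comp_tensorHom, Category.id_comp]
    _ = ((assocB X Y Z).inv ⊚ₘ (assocB X Y Z).inv) ≫ ζ (X ⊙ Y) Z (X ⊙ Y) Z ≫
          ζ X Y X Y ▷ᵦ (Z ⊚ Z) ≫ ((mO X ⊙ₘ mO Y) ⊙ₘ mO Z) := by
        rw [Category.assoc, Category.assoc, h2, ← reassoc_of% h]
    _ = _ := by
        rw [← Bul.tensorHom_id, Bul.tensorHom_comp_tensorHom, Category.id_comp, mO_bul, mO_bul]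

end Interchange

/-! ### The bimodule `N ⊗ M` over two monoids, and transport of bimodule axioms along isomorphisms.
-/

section FreeBimodule

open MonoidalCategory

variable {D : Type u} [Category.{v} D] [MonoidalCategory D]

lemma free_one_left (N M : D) [MonObj N] :
    (MonObj.one : 𝟙_ D ⟶ N) ▷ (N ⊗ M) ≫ (α_ N N M).inv ≫ MonObj.mul ▷ M =
      (λ_ (N ⊗ M)).hom := by
  rw [associator_inv_naturality_left_assoc, ← comp_whiskerRight, MonObj.one_mul]
  simp

lemma free_mul_left (N M : D) [MonObj N] :
    (MonObj.mul : N ⊗ N ⟶ N) ▷ (N ⊗ M) ≫ (α_ N N M).inv ≫ MonObj.mul ▷ M =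
      (α_ N N (N ⊗ M)).hom ≫ N ◁ ((α_ N N M).inv ≫ MonObj.mul ▷ M) ≫
        (α_ N N M).inv ≫ MonObj.mul ▷ M := by
  rw [associator_inv_naturality_left_assoc, ← comp_whiskerRight, MonObj.mul_assoc]
  simp

lemma free_right_one (N M : D) [MonObj M] :
    (N ⊗ M) ◁ (MonObj.one : 𝟙_ D ⟶ M) ≫ (α_ N M M).hom ≫ N ◁ MonObj.mul =
      (ρ_ (N ⊗ M)).hom := by
  rw [associator_naturality_right_assoc, ← whiskerLeft_comp, MonObj.mul_one]
  simp

lemma free_right_mul (N M : D) [MonObj M] :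
    (N ⊗ M) ◁ (MonObj.mul : M ⊗ M ⟶ M) ≫ (α_ N M M).hom ≫ N ◁ MonObj.mul =
      (α_ (N ⊗ M) M M).inv ≫ ((α_ N M M).hom ≫ N ◁ MonObj.mul) ▷ M ≫
        (α_ N M M).hom ≫ N ◁ MonObj.mul := by
  have h : M ◁ MonObj.mul ≫ MonObj.mul = (α_ M M M).inv ≫ MonObj.mul ▷ M ≫ MonObj.mul := by
    simp [MonObj.mul_assoc]
  rw [associator_naturality_right_assoc, ← whiskerLeft_comp, h]
  simp [-whiskerLeft_comp, ← whiskerLeft_comp]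

lemma free_middle (N M : D) [MonObj N] [MonObj M] :
    ((α_ N N M).inv ≫ MonObj.mul ▷ M) ▷ M ≫ (α_ N M M).hom ≫ N ◁ MonObj.mul =
      (α_ N (N ⊗ M) M).hom ≫ N ◁ ((α_ N M M).hom ≫ N ◁ MonObj.mul) ≫
        (α_ N N M).inv ≫ MonObj.mul ▷ M := by
  have h : (MonObj.mul ▷ M) ▷ M ≫ (α_ N M M).hom ≫ N ◁ MonObj.mul =
      (α_ (N ⊗ N) M M).hom ≫ (N ⊗ N) ◁ MonObj.mul ≫ MonObj.mul ▷ M := by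
    rw [whisker_exchange, associator_naturality_left_assoc]
  rw [comp_whiskerRight, Category.assoc, h]
  simp

variable {N M P Q : D} (φ : Q ≅ P) {l : N ⊗ P ⟶ P} {r : P ⊗ M ⟶ P} {l' : N ⊗ Q ⟶ Q}
  {r' : Q ⊗ M ⟶ Q}

lemma transport_one_left {o : 𝟙_ D ⟶ N} (hl : N ◁ φ.hom ≫ l = l' ≫ φ.hom)
    (h : o ▷ Q ≫ l' = (λ_ Q).hom) : o ▷ P ≫ l = (λ_ P).hom := by
  rw [← cancel_epi (_ ◁ φ.hom), whisker_exchange_assoc, hl, reassoc_of% h,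
    leftUnitor_naturality]

lemma transport_right_one {o : 𝟙_ D ⟶ M} (hr : φ.hom ▷ M ≫ r = r' ≫ φ.hom)
    (h : Q ◁ o ≫ r' = (ρ_ Q).hom) : P ◁ o ≫ r = (ρ_ P).hom := by
  rw [← cancel_epi (φ.hom ▷ _), ← whisker_exchange_assoc, hr, reassoc_of% h,
    rightUnitor_naturality]

lemma transport_mul_left {m : N ⊗ N ⟶ N} (hl : N ◁ φ.hom ≫ l = l' ≫ φ.hom)
    (h : m ▷ Q ≫ l' = (α_ N N Q).hom ≫ N ◁ l' ≫ l') :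
    m ▷ P ≫ l = (α_ N N P).hom ≫ N ◁ l ≫ l := by
  rw [← cancel_epi (_ ◁ φ.hom), whisker_exchange_assoc, hl, reassoc_of% h,
    associator_naturality_right_assoc, ← whiskerLeft_comp_assoc, hl, whiskerLeft_comp_assoc, hl]

lemma transport_right_mul {m : M ⊗ M ⟶ M} (hr : φ.hom ▷ M ≫ r = r' ≫ φ.hom)
    (h : Q ◁ m ≫ r' = (α_ Q M M).inv ≫ r' ▷ M ≫ r') :
    P ◁ m ≫ r = (α_ P M M).inv ≫ r ▷ M ≫ r := by
  rw [← cancel_epi (φ.hom ▷ _), ← whisker_exchange_assoc, hr, reassoc_of% h,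
    associator_inv_naturality_left_assoc, ← comp_whiskerRight_assoc, hr, comp_whiskerRight_assoc,
    hr]

lemma transport_middle (hl : N ◁ φ.hom ≫ l = l' ≫ φ.hom) (hr : φ.hom ▷ M ≫ r = r' ≫ φ.hom)
    (h : l' ▷ M ≫ r' = (α_ N Q M).hom ≫ N ◁ r' ≫ l') :
    l ▷ M ≫ r = (α_ N P M).hom ≫ N ◁ r ≫ l := by
  rw [← cancel_epi ((N ◁ φ.hom) ▷ M), ← comp_whiskerRight_assoc, hl, comp_whiskerRight_assoc, hr,
    reassoc_of% h, associator_naturality_middle_assoc, ← whiskerLeft_comp_assoc, hr,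
    whiskerLeft_comp_assoc, hl]

end FreeBimodule

/-! ### The bimodules `J ∘ M`. -/

section Bimodules

variable {C : Type u} [Category.{v} C] [DuoidalCategory C]

/-- The monoid `J`. -/
instance uJMonObj : MonObj (uJ C) where
  one := τ
  mul := ϖ
  one_mul := τ_ϖ
  mul_one := ϖ_τ
  mul_assoc := ϖ_assoc

lemma Jtensor_isBimodule {M : PreMon C} (hM : M.IsMonoid) : (Jtensor M).IsBimodule := by
  obtain ⟨m, h1, h2⟩ := hM
  obtain ⟨X, mul, one⟩ := M
  dsimp only at h1 h2 m
  subst h1 h2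
  exact ⟨free_one_left (uJ C) X, free_mul_left (uJ C) X, free_right_one (uJ C) X,
    free_right_mul (uJ C) X, free_middle (uJ C) X⟩

/-- The axioms for `P` are not assumed but transported from `Q`. Hence the base objects need no
separate proof of the bimodule axioms. -/
lemma isoAsBimodules_of_iso {M N : PreMon C} {P Q : PreBimod M N} (hQ : Q.IsBimodule)
    (φ : Q.X ≅ P.X) (hl : M.X ◁ₒ φ.hom ≫ P.left = Q.left ≫ φ.hom)
    (hr : φ.hom ▷ₒ N.X ≫ P.right = Q.right ≫ φ.hom) : IsoAsBimodules P Q := by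
  refine ⟨⟨transport_one_left φ hl hQ.one_left, transport_mul_left φ hl hQ.mul_left,
    transport_right_one φ hr hQ.right_one, transport_right_mul φ hr hQ.right_mul,
    transport_middle φ hl hr hQ.middle⟩, hQ, φ.symm, ?_, ?_⟩
  · rw [← cancel_mono φ.hom]
    have h : M.X ◁ₒ φ.inv ≫ M.X ◁ₒ φ.hom = 𝟙 _ := by
      rw [← MonoidalCategory.whiskerLeft_comp, φ.inv_hom_id, MonoidalCategory.whiskerLeft_id]
    simp only [Iso.symm_hom, Category.assoc, Iso.inv_hom_id, Category.comp_id]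
    rw [← hl, reassoc_of% h]
  · rw [← cancel_mono φ.hom]
    have h : φ.inv ▷ₒ N.X ≫ φ.hom ▷ₒ N.X = 𝟙 _ := by
      rw [← MonoidalCategory.comp_whiskerRight, φ.inv_hom_id, MonoidalCategory.id_whiskerRight]
    simp only [Iso.symm_hom, Category.assoc, Iso.inv_hom_id, Category.comp_id]
    rw [← hr, reassoc_of% h]

end Bimodules

lemma Splitting.ι_comp {C : Type u} [Category.{v} C] {X : C} {p : X ⟶ X} (S : Splitting p) : S.ι ≫ p = S.ι := by
  have h := S.ι ≫= S.π_ι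
  rw [← h, ← Category.assoc, S.ι_π, Category.id_comp]

lemma Splitting.comp_π {C : Type u} [Category.{v} C] {X : C} {p : X ⟶ X} (S : Splitting p) : p ≫ S.π = S.π := by
  have h := S.π_ι =≫ S.π
  rw [← h, Category.assoc, S.ι_π, Category.comp_id]

instance Splitting.mono {C : Type u} [Category.{v} C] {X : C} {p : X ⟶ X} (S : Splitting p) : Mono S.ι :=
  mono_of_mono_fac S.ι_π

/-! ### The base monoid `R_•` as a submonoid of `I • A`. -/

section BulletBase

variable {C : Type u} [Category.{v} C] [d : DuoidalCategory C]

instance MonComon.instMonObj (A : C) [MonComon A] : MonObj A := MonComon.monObj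

section Definitions

variable (A : C) [MonComon A]

/-- Right multiplication by `IΔη`. -/
def mulIΔη : uI C ⊙ A ⟶ (uI C ⊙ A) ⊙ A :=
  (runitO (uI C ⊙ A)).inv ≫ (uI C ⊙ A) ◁ₒ IΔη A ≫ ζ (uI C) A (uI C ⊙ A) A ≫
    (lunitO (uI C ⊙ A)).hom ▷ᵦ (A ⊚ A) ≫ (uI C ⊙ A) ◁ᵦ μA A

/-- Left multiplication by `IΔη`. -/
def IΔηmul : uI C ⊙ A ⟶ (uI C ⊙ A) ⊙ A :=
  (lunitO (uI C ⊙ A)).inv ≫ IΔη A ▷ₒ (uI C ⊙ A) ≫ ζ (uI C ⊙ A) A (uI C) A ≫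
    (runitO (uI C ⊙ A)).hom ▷ᵦ (A ⊚ A) ≫ (uI C ⊙ A) ◁ᵦ μA A

/-- The coaction of `A` on `I ⊙ A`. -/
def coactIA : uI C ⊙ A ⟶ (uI C ⊙ A) ⊙ A := uI C ◁ᵦ ΔA A ≫ (assocB (uI C) A A).inv

/-- The counit of `A`, applied to the second factor. -/
def counitRight (X : C) : X ⊙ A ⟶ X := X ◁ᵦ εA A ≫ (runitB X).hom

/-- The variant of `sqcapRb` for the reversed first product. -/
def sqcapRb' : uI C ⊙ A ⟶ uI C ⊙ A :=
  (lunitO (uI C ⊙ A)).inv ≫ IΔη A ▷ₒ (uI C ⊙ A) ≫ ζ (uI C ⊙ A) A (uI C) A ≫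
    (runitO (uI C ⊙ A)).hom ▷ᵦ (A ⊚ A) ≫ (uI C ⊙ A) ◁ᵦ εμ A ≫ (runitB (uI C ⊙ A)).hom

end Definitions

variable {A : C} [MonComon A]

lemma ΔA_counit_left : ΔA A ≫ εA A ▷ᵦ A = (lunitB A).inv :=
  (MonComon.comonObj (A := A)).counit_comul

lemma ΔA_counit_right : ΔA A ≫ A ◁ᵦ εA A = (runitB A).inv :=
  (MonComon.comonObj (A := A)).comul_counit

lemma ΔA_coassoc : ΔA A ≫ A ◁ᵦ ΔA A = ΔA A ≫ ΔA A ▷ᵦ A ≫ (assocB A A A).hom :=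
  (MonComon.comonObj (A := A)).comul_assoc

/-- In elements this is `x ↦ (1 • x) Δ1`, a product in the monoid `(I • A) • A`: multiplying by the
unit in the left factor leaves only a unitor. Associativity of that monoid becomes available. -/
lemma mulIΔη_eq : mulIΔη A = rAct (oO (uI C ⊙ A) ▷ᵦ A) (IΔη A) := by
  change _ = (runitO _).inv ≫ conv _ _
  rw [conv_eq_left]
  change _ = (runitO _).inv ≫ (oO (uI C ⊙ A) ▷ᵦ A) ▷ₒ (uI C) ≫ ((uI C ⊙ A) ⊙ A) ◁ₒ IΔη A ≫
    mO ((uI C ⊙ A) ⊙ A)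
  rw [mO_bul, ← reassoc_of% (Circ.whisker_exchange (oO (uI C ⊙ A) ▷ᵦ A) (IΔη A)),
    reassoc_of% (ζ_natural₁ (oO (uI C ⊙ A)) A (uI C ⊙ A) A), Bul.tensorHom_def,
    ← Category.assoc (_ ▷ᵦ _) (_ ▷ᵦ _), ← Bul.comp_whiskerRight, oO_mul]
  rfl

lemma IΔηmul_eq : IΔηmul A = lAct (IΔη A) (oO (uI C ⊙ A) ▷ᵦ A) := by
  change _ = (lunitO _).inv ≫ conv _ _
  rw [conv_eq_left]
  change _ = (lunitO _).inv ≫ (IΔη A) ▷ₒ (uI C ⊙ A) ≫ ((uI C ⊙ A) ⊙ A) ◁ₒ (oO (uI C ⊙ A) ▷ᵦ A) ≫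
    mO ((uI C ⊙ A) ⊙ A)
  rw [mO_bul, reassoc_of% (ζ_natural₃ (uI C ⊙ A) A (oO (uI C ⊙ A)) A), Bul.tensorHom_def,
    ← Category.assoc (_ ▷ᵦ _) (_ ▷ᵦ _), ← Bul.comp_whiskerRight, mO_one]
  rfl

lemma counitRight_natural {X Y : C} (f : X ⟶ Y) :
    f ▷ᵦ A ≫ counitRight A Y = counitRight A X ≫ f := by
  rw [counitRight, counitRight, ← reassoc_of% (Bul.whisker_exchange f (εA A)),
    Bul.rightUnitor_naturality, Category.assoc]

lemma sqcapRb_eq : sqcapRb A = mulIΔη A ≫ counitRight A _ := by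
  simp only [sqcapRb, mulIΔη, counitRight, εμ, Category.assoc, Bul.whiskerLeft_comp]

lemma sqcapRb'_eq : sqcapRb' A = IΔηmul A ≫ counitRight A _ := by
  simp only [sqcapRb', IΔηmul, counitRight, εμ, Category.assoc, Bul.whiskerLeft_comp]

lemma coactIA_counit : coactIA A ≫ counitRight A _ = 𝟙 _ := by
  have h := @MonoidalCategory.rightUnitor_tensor_hom C _ TwoMonoidal.bul (uI C) A
  have h' : (assocB (uI C) A (uJ C)).inv ≫ (runitB (uI C ⊙ A)).hom = uI C ◁ᵦ (runitB A).hom := by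
    rw [Iso.inv_comp_eq]; exact h
  rw [coactIA, counitRight, Category.assoc,
    ← reassoc_of% (Bul.associator_inv_naturality_right (uI C) A (εA A)), h',
    ← Bul.whiskerLeft_comp, ← Bul.whiskerLeft_comp, reassoc_of% ΔA_counit_right,
    Iso.inv_hom_id, Bul.whiskerLeft_id]

lemma IΔη_coactIA :
    IΔη A ≫ coactIA A ▷ᵦ A ≫ (assocB (uI C ⊙ A) A A).hom ≫ (assocB (uI C) A (A ⊙ A)).hom =
      unitR A := by
  rw [IΔη, coactIA, unitR, Bul.comp_whiskerRight, Category.assoc, Category.assoc, Category.assoc,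
    ← reassoc_of% (Bul.associator_inv_naturality_middle (uI C) (ΔA A) A),
    Bul.pentagon_inv_hom, Iso.inv_hom_id_assoc, Δη]
  simp only [← Bul.whiskerLeft_comp, Category.assoc, ΔA_coassoc]

/-- This is (RRU) with the associators cancelled: the first leg `x = 1_1` satisfies `(1 • x) Δ1 =
Δx`. -/
lemma IΔη_mulIΔη (h : AxRRU A) : IΔη A ≫ mulIΔη A ▷ᵦ A = IΔη A ≫ coactIA A ▷ᵦ A := by
  have h1 := IΔη_coactIA (A := A)
  rw [← (show _ = unitR A from h), ← Category.assoc, ← Category.assoc (IΔη A),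
    ← cancel_mono ((assocB (uI C ⊙ A) A A).hom ≫ (assocB (uI C) A (A ⊙ A)).hom)] at *
  exact h1.symm

/-- Left multiplication by `IΔη` is right multiplication in the `∘`-reversed category, where (RLU)
reads as (RRU). -/
lemma IΔη_IΔηmul (h : AxRLU A) : IΔη A ≫ IΔηmul A ▷ᵦ A = IΔη A ≫ coactIA A ▷ᵦ A :=
  @IΔη_mulIΔη C _ (revO d) A (revOMonComon A) h

/-- As `sqcapRb` is `x ↦ 1_1 ε(x 1_2)`, a morphism applied afterwards only meets the leg `1_1`.
Identities verified on that leg thus hold on the whole image. -/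
lemma sqcapRb_comp {Y : C} (g : uI C ⊙ A ⟶ Y) :
    sqcapRb A ≫ g = (runitO (uI C ⊙ A)).inv ≫ (uI C ⊙ A) ◁ₒ (IΔη A ≫ g ▷ᵦ A) ≫ ζ (uI C) A Y A ≫
      (lunitO Y).hom ▷ᵦ (A ⊚ A) ≫ Y ◁ᵦ εμ A ≫ (runitB Y).hom := by
  rw [Circ.whiskerLeft_comp, Category.assoc, reassoc_of% (ζ_natural₃ (uI C) A g A),
    ← Category.assoc (_ ▷ᵦ _) (_ ▷ᵦ _), ← Bul.comp_whiskerRight, Circ.leftUnitor_naturality,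
    Bul.comp_whiskerRight, Category.assoc, ← reassoc_of% (Bul.whisker_exchange g (εμ A)),
    Bul.rightUnitor_naturality, sqcapRb]
  simp only [Category.assoc]

lemma sqcapRb_mulIΔη (h : AxRRU A) : sqcapRb A ≫ mulIΔη A = sqcapRb A ≫ coactIA A := by
  rw [sqcapRb_comp, sqcapRb_comp, IΔη_mulIΔη h]

lemma sqcapRb_IΔηmul (h : AxRLU A) : sqcapRb A ≫ IΔηmul A = sqcapRb A ≫ coactIA A := by
  rw [sqcapRb_comp, sqcapRb_comp, IΔη_IΔηmul h]

lemma sqcapRb_idem (h : AxRRU A) : sqcapRb A ≫ sqcapRb A = sqcapRb A := by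
  nth_rw 2 [sqcapRb_eq]
  rw [← Category.assoc, sqcapRb_mulIΔη h, Category.assoc, coactIA_counit, Category.comp_id]

/-- Together with `sqcapRb'_sqcapRb`, this shows that `x ↦ 1_1 ε(x 1_2)` and `x ↦ 1_1 ε(1_2 x)` have
the same image, although they may differ. -/
lemma sqcapRb_sqcapRb' (h : AxRLU A) : sqcapRb A ≫ sqcapRb' A = sqcapRb A := by
  rw [sqcapRb'_eq, ← Category.assoc, sqcapRb_IΔηmul h, Category.assoc, coactIA_counit,
    Category.comp_id]

lemma sqcapRb'_sqcapRb (h : AxRRU A) : sqcapRb' A ≫ sqcapRb A = sqcapRb' A :=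
  @sqcapRb_sqcapRb' C _ (revO d) A (revOMonComon A) h

/-- The first leg of `Δ1` lies in the base: apply the counit to the middle leg in (RRU). -/
lemma IΔη_sqcapRb (h : AxRRU A) : IΔη A ≫ sqcapRb A ▷ᵦ A = IΔη A := by
  rw [sqcapRb_eq, Bul.comp_whiskerRight, reassoc_of% (IΔη_mulIΔη h), ← Bul.comp_whiskerRight,
    coactIA_counit, Bul.id_whiskerRight, Category.comp_id]

lemma IΔη_sqcapRb' (h : AxRLU A) : IΔη A ≫ sqcapRb' A ▷ᵦ A = IΔη A :=
  @IΔη_sqcapRb C _ (revO d) A (revOMonComon A) h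

lemma isMul_coactIA (h : AxWB A) : IsMul (coactIA A) := by
  have h1 : IsMul (ΔA A) := by
    rw [isMul_iff, mO_bul]; exact h
  have h2 : IsMul (𝟙 (uI C) ⊙ₘ ΔA A) := isMul_id.bul h1
  rw [Bul.id_tensorHom] at h2
  exact h2.comp isMul_assocB_inv

lemma isMul_oO_whiskerRight : IsMul (oO (uI C ⊙ A) ▷ᵦ A) := by
  rw [← Bul.tensorHom_id]
  exact IsMul.bul (isMul_one (M := uI C ⊙ A)) isMul_id

lemma oO_IA : oO (uI C ⊙ A) = δ ≫ uI C ◁ᵦ ηA A := by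
  rw [oO_bul, ← Bul.id_tensorHom]; rfl

lemma oO_coactIA : oO (uI C ⊙ A) ≫ coactIA A = IΔη A := by
  rw [oO_IA, coactIA, IΔη, Δη, Bul.whiskerLeft_comp]
  simp only [Category.assoc]

/-- A multiplicative map sends the unit to an idempotent element. -/
lemma IΔη_conv_self (h : AxWB A) :
    conv (IΔη A) (IΔη A) = (lunitO (uI C)).hom ≫ IΔη A := by
  rw [← oO_coactIA, ← conv_comp (isMul_coactIA h)]
  have := isMul_one (M := uI C ⊙ A)
  change (lunitO (uI C)).hom ≫ oO (uI C ⊙ A) = conv (oO (uI C ⊙ A)) (oO (uI C ⊙ A)) at this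
  rw [← this, Category.assoc]

lemma oO_sqcapRb (h : AxRRU A) : oO (uI C ⊙ A) ≫ sqcapRb A = oO (uI C ⊙ A) := by
  have h1 : IΔη A ≫ counitRight A _ = oO (uI C ⊙ A) := by
    rw [← oO_coactIA, Category.assoc, coactIA_counit, Category.comp_id]
  have h2 := IΔη_sqcapRb h =≫ counitRight A _
  rw [Category.assoc, counitRight_natural, reassoc_of% h1] at h2
  rw [h2, h1]

lemma coactIA_counit_whiskerRight : coactIA A ≫ counitRight A (uI C) ▷ᵦ A = 𝟙 _ := by
  rw [coactIA, counitRight, Bul.comp_whiskerRight, Category.assoc,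
    ← reassoc_of% (Bul.associator_inv_naturality_middle (uI C) (εA A) A), Bul.triangle_inv,
    ← Bul.whiskerLeft_comp, ← Bul.whiskerLeft_comp, reassoc_of% ΔA_counit_left,
    Iso.inv_hom_id, Bul.whiskerLeft_id]

lemma conv_comp_oO_whiskerRight {X Y : C} (f : X ⟶ (uI C ⊙ A) ⊙ A) (g : Y ⟶ uI C ⊙ A) :
    conv f (g ≫ oO (uI C ⊙ A) ▷ᵦ A) = (f ⊚ₘ g) ≫ ζ (uI C ⊙ A) A (uI C) A ≫
      (runitO (uI C ⊙ A)).hom ▷ᵦ (A ⊚ A) ≫ (uI C ⊙ A) ◁ᵦ μA A := by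
  rw [← Category.comp_id f, comp_conv, conv_eq_left]
  change (_ ⊚ₘ _) ≫ 𝟙 ((uI C ⊙ A) ⊙ A) ▷ₒ (uI C ⊙ A) ≫ ((uI C ⊙ A) ⊙ A) ◁ₒ
    (oO (uI C ⊙ A) ▷ᵦ A) ≫ mO ((uI C ⊙ A) ⊙ A) = _
  rw [mO_bul, Circ.id_whiskerRight, Category.id_comp, Category.comp_id,
    reassoc_of% (ζ_natural₃ (uI C ⊙ A) A (oO (uI C ⊙ A)) A), Bul.tensorHom_def,
    ← Category.assoc (_ ▷ᵦ _) (_ ▷ᵦ _), ← Bul.comp_whiskerRight, mO_one]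

section Splitting

variable (S : Splitting (sqcapRb A))

lemma Rb.ι_mulIΔη (h : AxRRU A) : S.ι ≫ mulIΔη A = S.ι ≫ coactIA A := by
  rw [← S.ι_comp, Category.assoc, Category.assoc, sqcapRb_mulIΔη h]

lemma Rb.ι_IΔηmul (h : AxRLU A) : S.ι ≫ IΔηmul A = S.ι ≫ coactIA A := by
  rw [← S.ι_comp, Category.assoc, Category.assoc, sqcapRb_IΔηmul h]

/-- Closure of the base under products: `xy` again satisfies `Δ(xy) = (1 • xy) Δ1`, and the counit
turns this equation into invariance under `sqcapRb`. -/
lemma Rb.conv_ι_sqcapRb (hw : AxWB A) (h : AxRRU A) (h' : AxRLU A) :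
    conv S.ι S.ι ≫ sqcapRb A = conv S.ι S.ι := by
  have h1 : conv S.ι S.ι ≫ coactIA A = conv S.ι S.ι ≫ mulIΔη A := by
    -- The chain is `Δ(xy) = (1•x)Δ1 · Δ1(1•y) = (1•x)Δ1(1•y) = (1•x)(1•y)Δ1 = (1•xy)Δ1`, using
    -- idempotency of `Δ1` and that `Δ1` commutes with `1•y`.
    rw [conv_comp (isMul_coactIA hw)]
    nth_rw 1 [← Rb.ι_mulIΔη S h]
    rw [← Rb.ι_IΔηmul S h', mulIΔη_eq, IΔηmul_eq, ← comp_rAct, ← comp_lAct, rAct_conv,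
      lAct_lAct (IΔη_conv_self hw), comp_lAct, ← IΔηmul_eq, Rb.ι_IΔηmul S h',
      ← Rb.ι_mulIΔη S h, mulIΔη_eq, ← comp_rAct, conv_rAct,
      ← conv_comp isMul_oO_whiskerRight, comp_rAct]
  have h2 : conv S.ι S.ι ≫ sqcapRb A = conv S.ι S.ι ≫ mulIΔη A ≫ counitRight A _ := by
    rw [← sqcapRb_eq]
  rw [h2, ← Category.assoc, ← h1, Category.assoc, coactIA_counit, Category.comp_id]

lemma mulIΔη_comp {Y : C} (g : uI C ⊙ A ⟶ Y) :
    mulIΔη A ≫ g ▷ᵦ A = (runitO (uI C ⊙ A)).inv ≫ (uI C ⊙ A) ◁ₒ (IΔη A ≫ g ▷ᵦ A) ≫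
      ζ (uI C) A Y A ≫ (lunitO Y).hom ▷ᵦ (A ⊚ A) ≫ Y ◁ᵦ μA A := by
  rw [Circ.whiskerLeft_comp, Category.assoc, reassoc_of% (ζ_natural₃ (uI C) A g A),
    ← Category.assoc (_ ▷ᵦ _) (_ ▷ᵦ _), ← Bul.comp_whiskerRight, Circ.leftUnitor_naturality,
    Bul.comp_whiskerRight, Category.assoc, ← Bul.whisker_exchange g (μA A), mulIΔη]
  simp only [Category.assoc]

/-- On the base `Δx = 1_1 • x 1_2`, whose first leg already lies in the base, so the projection in
the coaction loses nothing. -/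
lemma Rb.coact_ι (h : AxRRU A) : Rb.coact S ≫ S.ι ▷ᵦ A = S.ι ≫ coactIA A := by
  have h1 : Rb.coact S ≫ S.ι ▷ᵦ A = S.ι ≫ coactIA A ≫ sqcapRb A ▷ᵦ A := by
    have h2 : S.π ▷ᵦ A ≫ S.ι ▷ᵦ A = sqcapRb A ▷ᵦ A := by
      rw [← Bul.comp_whiskerRight, S.π_ι]
    rw [← h2, Rb.coact, coactIA]
    simp only [Category.assoc]
  rw [h1, ← Category.assoc, ← Rb.ι_mulIΔη S h, Category.assoc, mulIΔη_comp, IΔη_sqcapRb h]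
  rfl

/-- The multiplication of `R_•`. -/
def Rb.mulHom : S.obj ⊚ S.obj ⟶ S.obj :=
  Rb.χ S ≫ S.obj ◁ₒ (S.ι ≫ uI C ◁ᵦ εA A ≫ (runitB (uI C)).hom) ≫ (runitO S.obj).hom

/-- The unit of `R_•`. -/
def Rb.oneHom : uI C ⟶ S.obj := δ ≫ uI C ◁ᵦ ηA A ≫ S.π

/-- The multiplication through `χ` is the one inherited from `I • A`, so the monoid axioms follow by
cancelling the monomorphism `ι`. -/
lemma Rb.mul_ι (hw : AxWB A) (h : AxRRU A) (h' : AxRLU A) :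
    Rb.mulHom S ≫ S.ι = conv S.ι S.ι := by
  have h1 : S.obj ◁ₒ (S.ι ≫ counitRight A (uI C)) ≫ (runitO S.obj).hom ≫ S.ι =
      (S.ι ⊚ₘ S.ι) ≫ (uI C ⊙ A) ◁ₒ counitRight A (uI C) ≫ (runitO (uI C ⊙ A)).hom := by
    rw [← Circ.rightUnitor_naturality, Circ.tensorHom_def, Circ.whiskerLeft_comp, Category.assoc,
      Category.assoc, reassoc_of% (Circ.whisker_exchange S.ι (counitRight A (uI C))),
      reassoc_of% (Circ.whisker_exchange S.ι S.ι)]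
  have h2 : Rb.mulHom S ≫ S.ι = Rb.χ S ≫
      (S.ι ⊚ₘ S.ι) ≫ (uI C ⊙ A) ◁ₒ counitRight A (uI C) ≫ (runitO (uI C ⊙ A)).hom := by
    rw [← h1, Rb.mulHom, counitRight]
    simp only [Category.assoc]
  have h3 (g : S.obj ⊚ S.obj ⟶ uI C ⊙ A) : Rb.χ S ≫ g = (Rb.coact S ⊚ₘ Rb.coact S) ≫
      ζ S.obj A S.obj A ≫ g ▷ᵦ (A ⊚ A) ≫ (uI C ⊙ A) ◁ᵦ εμ A ≫ (runitB (uI C ⊙ A)).hom := by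
    rw [← reassoc_of% (Bul.whisker_exchange g (εμ A)), Bul.rightUnitor_naturality, Rb.χ]
    simp only [Category.assoc]
  have h4 := ζ_natural S.ι (𝟙 A) S.ι (𝟙 A)
  simp only [Bul.tensorHom_id, Circ.tensorHom_id, Circ.id_whiskerRight] at h4
  -- The left side is `x_1 ε(y_1) ε(x_2 y_2)`; counitality in `y` reduces it to `x_1 ε(x_2 y)`.
  rw [h2, h3, Bul.comp_whiskerRight, Bul.comp_whiskerRight, Category.assoc, Category.assoc,
    ← reassoc_of% h4, ← Category.assoc (_ ⊚ₘ _) (_ ⊚ₘ _), Circ.tensorHom_comp_tensorHom,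
    Rb.coact_ι S h, ← reassoc_of% (ζ_natural₃ (uI C ⊙ A) A (counitRight A (uI C)) A),
    ← Circ.id_tensorHom, ← Category.assoc (_ ⊚ₘ _) (_ ⊚ₘ _), Circ.tensorHom_comp_tensorHom,
    Category.comp_id, Category.assoc S.ι, coactIA_counit_whiskerRight, Category.comp_id]
  have h5 : conv S.ι S.ι ≫ sqcapRb' A = conv S.ι S.ι := by
    rw [← Rb.conv_ι_sqcapRb S hw h h', Category.assoc, sqcapRb_sqcapRb' h']
  -- On the right, `xy = 1_1 ε(1_2 xy)`, and `Δ1 (1 • x) = Δx` turns this into `x_1 ε(x_2 y)` as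
  -- well.
  rw [← h5, sqcapRb'_eq, IΔηmul_eq, ← Category.assoc (conv _ _), ← comp_lAct,
    conv_comp isMul_oO_whiskerRight, ← lAct_conv, comp_lAct, ← IΔηmul_eq, Rb.ι_IΔηmul S h',
    conv_comp_oO_whiskerRight, counitRight, εμ, Bul.whiskerLeft_comp]
  simp only [Category.assoc]

lemma Rb.one_ι (h : AxRRU A) : Rb.oneHom S ≫ S.ι = oO (uI C ⊙ A) := by
  rw [← oO_sqcapRb h, oO_IA]
  have h2 := (δ ≫ uI C ◁ᵦ ηA A) ≫= S.π_ι
  rw [← h2, Rb.oneHom]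
  simp only [Category.assoc]

theorem Rb.isMonoid (hw : AxWB A) (h : AxRRU A) (h' : AxRLU A) : (Rb.mon S).IsMonoid :=
  ⟨monObjOfMono (R := S.obj) S.ι (Rb.mulHom S) (Rb.oneHom S) (Rb.mul_ι S hw h h') (Rb.one_ι S h), rfl, rfl⟩

/-- This is the left unitality of `ζ` for `•`, since `J` multiplies by `ϖ`. -/
lemma isMul_lunitB : IsMul (lunitB A).hom := by
  have h := ζ_unit_leftB A A
  have h1 : ζ (uJ C) A (uJ C) A ≫ ϖ ▷ᵦ (A ⊚ A) ≫ (lunitB (A ⊚ A)).hom =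
      (lunitB A).hom ⊚ₘ (lunitB A).hom := by
    rw [← cancel_epi ((lunitB A).inv ⊚ₘ (lunitB A).inv), h, Circ.tensorHom_comp_tensorHom,
      Iso.inv_hom_id, Circ.tensorHom_id, Circ.id_whiskerRight]
  rw [isMul_iff, mO_bul, ← h1, Bul.tensorHom_def]
  simp only [Category.assoc]
  rw [Bul.leftUnitor_naturality]
  rfl

/-- The monoid morphism `I ⊙ A → A`. -/
def toAIA (A : C) : uI C ⊙ A ⟶ A := τ ▷ᵦ A ≫ (lunitB A).hom

lemma isMul_toAIA : IsMul (toAIA A) := by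
  have h : IsMul (τ ⊙ₘ 𝟙 A) := IsMul.bul (isMul_one (M := uJ C)) isMul_id
  rw [Bul.tensorHom_id] at h
  exact h.comp isMul_lunitB

lemma Rb.mul_toA (hw : AxWB A) (h : AxRRU A) (h' : AxRLU A) :
    Rb.mulHom S ≫ Rb.toA S = (Rb.toA S ⊚ₘ Rb.toA S) ≫ μA A := by
  change Rb.mulHom S ≫ S.ι ≫ toAIA A = conv (S.ι ≫ toAIA A) (S.ι ≫ toAIA A)
  rw [← Category.assoc, Rb.mul_ι S hw h h', conv_comp isMul_toAIA]

end Splitting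

end BulletBase

/-! ### Comparison of `R_∘` with `J ∘ R_•` and `J ∘ L_•`. -/

section Comparison

variable {C : Type u} [Category.{v} C] [d : DuoidalCategory C] {A : C} [MonComon A]

section Definitions

variable (A)

/-- The action of `X ⊙ A` on `J ⊚ A`, its second factor being evaluated by `Jεμ`. -/
def evalJεμ (X : C) : (uJ C ⊚ A) ⊚ (X ⊙ A) ⟶ uJ C ⊚ X :=
  (lunitB (uJ C ⊚ A)).inv ▷ₒ (X ⊙ A) ≫ ζ (uJ C) (uJ C ⊚ A) X A ≫
    (uJ C ⊚ X) ◁ᵦ Jεμ A ≫ (runitB (uJ C ⊚ X)).hom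

/-- The comparison morphism from `J ⊚ A` to `J ⊚ (I ⊙ A)`. -/
def comparison : uJ C ⊚ A ⟶ uJ C ⊚ (uI C ⊙ A) :=
  (runitO (uJ C ⊚ A)).inv ≫ (uJ C ⊚ A) ◁ₒ IΔη A ≫ evalJεμ A (uI C ⊙ A)

/-- The left action of `J` on `J ⊚ A`. -/
def actJA : uJ C ⊚ (uJ C ⊚ A) ⟶ uJ C ⊚ A := (assocO (uJ C) (uJ C) A).inv ≫ ϖ ▷ₒ A

/-- The right action of `A` on `J ⊚ A`. -/
def JAact : (uJ C ⊚ A) ⊚ A ⟶ uJ C ⊚ A := (assocO (uJ C) A A).hom ≫ uJ C ◁ₒ μA A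

end Definitions

lemma μA_assoc : μA A ▷ₒ A ≫ μA A = (assocO A A A).hom ≫ A ◁ₒ μA A ≫ μA A := mO_assoc A

lemma ηA_μA : ηA A ▷ₒ A ≫ μA A = (lunitO A).hom := oO_mul A

lemma sqcapRo_eq :
    sqcapRo A = (runitO (uJ C ⊚ A)).inv ≫ (uJ C ⊚ A) ◁ₒ Δη A ≫ evalJεμ A A := rfl

lemma evalJεμ_natural {X Y : C} (g : X ⟶ Y) :
    (uJ C ⊚ A) ◁ₒ (g ▷ᵦ A) ≫ evalJεμ A Y = evalJεμ A X ≫ uJ C ◁ₒ g := by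
  rw [evalJεμ, evalJεμ, reassoc_of% (Circ.whisker_exchange (lunitB (uJ C ⊚ A)).inv (g ▷ᵦ A)),
    reassoc_of% (ζ_natural₃ (uJ C) (uJ C ⊚ A) g A),
    ← reassoc_of% (Bul.whisker_exchange (uJ C ◁ₒ g) (Jεμ A)), Bul.rightUnitor_naturality]
  simp only [Category.assoc]

/-- The evaluation depends on its first argument `a` only through the functional `b ↦ ε(a b)`. The
same then holds for `sqcapRo` and `comparison`, which reduces identities about them to identities
about `Jεμ`. -/
lemma evalJεμ_congr {Z : C} {f g : Z ⟶ uJ C ⊚ A} (h : f ▷ₒ A ≫ Jεμ A = g ▷ₒ A ≫ Jεμ A) (X : C) :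
    f ▷ₒ (X ⊙ A) ≫ evalJεμ A X = g ▷ₒ (X ⊙ A) ≫ evalJεμ A X := by
  have key (k : Z ⟶ uJ C ⊚ A) : k ▷ₒ (X ⊙ A) ≫ evalJεμ A X = (lunitB Z).inv ▷ₒ (X ⊙ A) ≫
      ζ (uJ C) Z X A ≫ (uJ C ⊚ X) ◁ᵦ (k ▷ₒ A ≫ Jεμ A) ≫ (runitB (uJ C ⊚ X)).hom := by
    rw [evalJεμ, ← Category.assoc, ← Circ.comp_whiskerRight, Bul.leftUnitor_inv_naturality,
      Circ.comp_whiskerRight, Category.assoc, reassoc_of% (ζ_natural₂ (uJ C) k X A),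
      Bul.whiskerLeft_comp, Category.assoc]
  rw [key, key, h]

lemma comp_evalJεμ {Z X : C} (f : Z ⟶ uJ C ⊚ A) (e : uI C ⟶ X ⊙ A) :
    f ≫ (runitO (uJ C ⊚ A)).inv ≫ (uJ C ⊚ A) ◁ₒ e ≫ evalJεμ A X =
      (runitO Z).inv ≫ Z ◁ₒ e ≫ f ▷ₒ (X ⊙ A) ≫ evalJεμ A X := by
  rw [reassoc_of% (Circ.rightUnitor_inv_naturality f), reassoc_of% (Circ.whisker_exchange f e)]

lemma comp_sqcapRo_congr {Z : C} {f g : Z ⟶ uJ C ⊚ A} (h : f ▷ₒ A ≫ Jεμ A = g ▷ₒ A ≫ Jεμ A) :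
    f ≫ sqcapRo A = g ≫ sqcapRo A := by
  rw [sqcapRo_eq, comp_evalJεμ, comp_evalJεμ, evalJεμ_congr h]

lemma comp_comparison_congr {Z : C} {f g : Z ⟶ uJ C ⊚ A}
    (h : f ▷ₒ A ≫ Jεμ A = g ▷ₒ A ≫ Jεμ A) : f ≫ comparison A = g ≫ comparison A := by
  rw [comparison, comp_evalJεμ, comp_evalJεμ, evalJεμ_congr h]

lemma comparison_comp {Y : C} (g : uI C ⊙ A ⟶ Y) :
    comparison A ≫ uJ C ◁ₒ g =
      (runitO (uJ C ⊚ A)).inv ≫ (uJ C ⊚ A) ◁ₒ (IΔη A ≫ g ▷ᵦ A) ≫ evalJεμ A Y := by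
  rw [comparison, Circ.whiskerLeft_comp]
  simp only [Category.assoc]
  rw [evalJεμ_natural]

/-- The values of `comparison` are built from the first leg of `Δ1`, which lies in the base. -/
lemma comparison_sqcapRb (h : AxRRU A) : comparison A ≫ uJ C ◁ₒ sqcapRb A = comparison A := by
  rw [comparison_comp, IΔη_sqcapRb h]; rfl

lemma comparison_sqcapRb' (h : AxRLU A) : comparison A ≫ uJ C ◁ₒ sqcapRb' A = comparison A := by
  rw [comparison_comp, IΔη_sqcapRb' h]; rfl

/-- The auxiliary `I` created by `δ` is removed by the counit law of `(I, δ, τ)`. -/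
lemma IΔη_toAIA : IΔη A ≫ toAIA A ▷ᵦ A = Δη A := by
  rw [IΔη, toAIA, Bul.comp_whiskerRight]
  simp only [Category.assoc]
  rw [← reassoc_of% (Bul.associator_inv_naturality_left τ A A), ← Bul.leftUnitor_tensor,
    reassoc_of% (Bul.whisker_exchange τ (Δη A)), Bul.leftUnitor_naturality, reassoc_of% δ_τ_left,
    Iso.inv_hom_id_assoc]

lemma comparison_toAIA : comparison A ≫ uJ C ◁ₒ toAIA A = sqcapRo A := by
  rw [comparison_comp, IΔη_toAIA, sqcapRo_eq]

/-- Put the unit in the middle argument of (LLC): `ε(a b_2) ε(b_1 c) = ε(a b c)` at `b = 1` reads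
`ε(a 1_2) ε(1_1 c) = ε(a c)`. -/
lemma sqcapRo_Jεμ (h : AxLLC A) : sqcapRo A ▷ₒ A ≫ Jεμ A = Jεμ A := by
  have h1 : ((uJ C ⊚ A) ◁ₒ ΔA A ≫ evalJεμ A A) ▷ₒ A ≫ Jεμ A =
      (assocO (uJ C ⊚ A) A A).hom ≫ (assocO (uJ C) A (A ⊚ A)).hom ≫ counitL A := by
    rw [← (show _ = counitL A from h), Iso.hom_inv_id_assoc, Iso.hom_inv_id_assoc, evalJεμ]
  have h2 : sqcapRo A = (runitO (uJ C ⊚ A)).inv ≫ (uJ C ⊚ A) ◁ₒ ηA A ≫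
      (uJ C ⊚ A) ◁ₒ ΔA A ≫ evalJεμ A A := by
    rw [sqcapRo_eq, Δη, Circ.whiskerLeft_comp]
    simp only [Category.assoc]
  have h3 : (runitO (uJ C ⊚ A)).inv ▷ₒ A ≫ (assocO (uJ C ⊚ A) (uI C) A).hom ≫
      (uJ C ⊚ A) ◁ₒ (lunitO A).hom = 𝟙 _ := by
    rw [Circ.triangle, ← Circ.comp_whiskerRight, Iso.inv_hom_id, Circ.id_whiskerRight]
  rw [h2, Circ.comp_whiskerRight, Circ.comp_whiskerRight, Category.assoc, Category.assoc, h1,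
    reassoc_of% (Circ.associator_naturality_middle (uJ C ⊚ A) (ηA A) A), counitL,
    reassoc_of% (Circ.associator_naturality_right (uJ C) A (ηA A ▷ₒ A)),
    ← Category.assoc (uJ C ◁ₒ (A ◁ₒ _)), ← Circ.whiskerLeft_comp, ← Circ.whiskerLeft_comp, ηA_μA,
    ← reassoc_of% (Circ.associator_naturality_right (uJ C) A (lunitO A).hom), reassoc_of% h3,
    Jεμ, εμ, Circ.whiskerLeft_comp]
  simp only [Category.assoc]

lemma sqcapRo_comparison (h : AxLLC A) : sqcapRo A ≫ comparison A = comparison A := by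
  have := comp_comparison_congr (f := sqcapRo A) (g := 𝟙 _)
    (by rw [sqcapRo_Jεμ h, Circ.id_whiskerRight, Category.id_comp])
  rw [this, Category.id_comp]

lemma actJA_Jεμ : actJA A ▷ₒ A ≫ Jεμ A =
    (assocO (uJ C) (uJ C ⊚ A) A).hom ≫ uJ C ◁ₒ Jεμ A ≫ ϖ := by
  have h := Circ.pentagon_inv_hom (uJ C) (uJ C) A A
  rw [actJA, Jεμ, Circ.comp_whiskerRight, Category.assoc,
    reassoc_of% (Circ.associator_naturality_left ϖ A A),
    ← reassoc_of% (Circ.whisker_exchange ϖ (εμ A)), ϖ_assoc,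
    reassoc_of% (Circ.associator_naturality_right (uJ C) (uJ C) (εμ A)), reassoc_of% h]
  simp only [Circ.whiskerLeft_comp, Category.assoc]

lemma μA_εμ : μA A ▷ₒ A ≫ εμ A = (assocO A A A).hom ≫ A ◁ₒ μA A ≫ εμ A := by
  rw [εμ, reassoc_of% (μA_assoc (A := A))]

lemma JAact_Jεμ : JAact A ▷ₒ A ≫ Jεμ A =
    (assocO (uJ C ⊚ A) A A).hom ≫ (uJ C ⊚ A) ◁ₒ μA A ≫ Jεμ A := by
  have h := Circ.pentagon (uJ C) A A A
  rw [JAact, Jεμ, Circ.comp_whiskerRight, Category.assoc,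
    reassoc_of% (Circ.associator_naturality_middle (uJ C) (μA A) A),
    ← Category.assoc (uJ C ◁ₒ _) (uJ C ◁ₒ _), ← Circ.whiskerLeft_comp, μA_εμ,
    Circ.whiskerLeft_comp, Category.assoc, reassoc_of% h,
    reassoc_of% (Circ.associator_naturality_right (uJ C) A (μA A)), Circ.whiskerLeft_comp,
    Category.assoc]

/-- By `comp_sqcapRo_congr` it suffices to compare under `Jεμ`, where the `J`-action passes outside
and `sqcapRo` is absorbed. For the `A`-action in `JAact_sqcapRo`, associativity of `μ` plays the
corresponding role. -/
lemma actJA_sqcapRo (h : AxLLC A) :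
    uJ C ◁ₒ sqcapRo A ≫ actJA A ≫ sqcapRo A = actJA A ≫ sqcapRo A := by
  rw [← Category.assoc]
  apply comp_sqcapRo_congr
  rw [Circ.comp_whiskerRight, Category.assoc, actJA_Jεμ,
    reassoc_of% (Circ.associator_naturality_middle (uJ C) (sqcapRo A) A),
    ← Category.assoc (uJ C ◁ₒ _) (uJ C ◁ₒ _), ← Circ.whiskerLeft_comp, sqcapRo_Jεμ h]

lemma JAact_sqcapRo (h : AxLLC A) :
    sqcapRo A ▷ₒ A ≫ JAact A ≫ sqcapRo A = JAact A ≫ sqcapRo A := by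
  rw [← Category.assoc]
  apply comp_sqcapRo_congr
  rw [Circ.comp_whiskerRight, Category.assoc, JAact_Jεμ,
    reassoc_of% (Circ.associator_naturality_left (sqcapRo A) A A),
    ← reassoc_of% (Circ.whisker_exchange (sqcapRo A) (μA A)), sqcapRo_Jεμ h]

-- The `τ` inside `toAIA` cancels against `ϖ`, so the unit `J` needed to apply `ζ` to `J ∘ A` can be
-- split off from `J` before `toAIA` is applied.
omit [MonComon A] in
lemma leftO_toAIA_lunitB_inv : uJ C ◁ₒ toAIA A ≫ (lunitB (uJ C ⊚ A)).inv =
    (lunitB (uJ C)).inv ▷ₒ (uI C ⊙ A) ≫ ζ (uJ C) (uJ C) (uI C) A ≫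
      (runitO (uJ C)).hom ▷ᵦ (uJ C ⊚ A) := by
  have h := ζ_unit_leftB (uJ C) A
  have h1 : (lunitB (uJ C ⊚ A)).inv = ((lunitB (uJ C)).inv ⊚ₘ (lunitB A).inv) ≫
      ζ (uJ C) (uJ C) (uJ C) A ≫ ϖ ▷ᵦ (uJ C ⊚ A) := by
    rw [← cancel_mono (lunitB (uJ C ⊚ A)).hom, Iso.inv_hom_id, ← h]
    simp only [Category.assoc]
  rw [h1, ← Category.assoc, ← Circ.id_tensorHom, Circ.tensorHom_comp_tensorHom, Category.id_comp,
    toAIA, Category.assoc, Iso.hom_inv_id, Category.comp_id, Circ.tensorHom_def, Category.assoc,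
    reassoc_of% (ζ_natural₃ (uJ C) (uJ C) τ A), ← Bul.comp_whiskerRight, ϖ_τ]

lemma lunitB_inv_ζ_runitB (X : C) : (lunitB (uJ C)).inv ▷ₒ (X ⊙ uJ C) ≫
    ζ (uJ C) (uJ C) X (uJ C) ≫ (uJ C ⊚ X) ◁ᵦ ϖ ≫ (runitB (uJ C ⊚ X)).hom =
      uJ C ◁ₒ (runitB X).hom := by
  have h := ζ_unit_rightB (uJ C) X
  have h1 : (lunitB (uJ C)).inv = (runitB (uJ C)).inv := by
    rw [← cancel_mono (lunitB (uJ C)).hom, Iso.inv_hom_id, Bul.unitors_equal, Iso.inv_hom_id]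
  have h2 := uJ C ◁ₒ (runitB X).hom ≫= h
  rw [← Category.assoc, ← Circ.id_tensorHom, Circ.tensorHom_comp_tensorHom, Category.id_comp,
    Iso.hom_inv_id, Circ.tensorHom_id, Category.comp_id, Circ.id_tensorHom] at h2
  rw [h1, h2]

/-- With the `J • J` split off, `∘`-associativity of `ζ` moves the evaluation inside `J ∘ -`. The
remaining interchange with `J` is trivial by unitality (`lunitB_inv_ζ_runitB`). -/
lemma leftO_toAIA_evalJεμ (X : C) : (uJ C ◁ₒ toAIA A) ▷ₒ (X ⊙ A) ≫ evalJεμ A X =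
    (assocO (uJ C) (uI C ⊙ A) (X ⊙ A)).hom ≫ uJ C ◁ₒ (ζ (uI C) A X A ≫
      (lunitO X).hom ▷ᵦ (A ⊚ A) ≫ X ◁ᵦ εμ A ≫ (runitB X).hom) := by
  have h1 := ζ_assocO (uJ C) (uJ C) (uI C) A X A
  have h2 : ζ (uJ C) (uJ C) (uI C) A ▷ₒ (X ⊙ A) ≫ ζ (uJ C ⊚ uI C) (uJ C ⊚ A) X A =
      (assocO _ _ _).hom ≫ (uJ C ⊙ uJ C) ◁ₒ ζ (uI C) A X A ≫
        ζ (uJ C) (uJ C) (uI C ⊚ X) (A ⊚ A) ≫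
          ((assocO (uJ C) (uI C) X).inv ⊙ₘ (assocO (uJ C) A A).inv) := by
    have h3 := h1 =≫ ((assocO (uJ C) (uI C) X).inv ⊙ₘ (assocO (uJ C) A A).inv)
    simp only [Category.assoc] at h3
    rw [← h3, Bul.tensorHom_comp_tensorHom, Iso.hom_inv_id, Iso.hom_inv_id, Bul.tensorHom_id,
      Bul.id_whiskerRight, Category.comp_id]
  have h4 : ((assocO (uJ C) (uI C) X).inv ⊙ₘ (assocO (uJ C) A A).inv) ≫
      ((runitO (uJ C)).hom ▷ₒ X) ▷ᵦ ((uJ C ⊚ A) ⊚ A) ≫ (uJ C ⊚ X) ◁ᵦ Jεμ A =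
        (uJ C ◁ₒ (lunitO X).hom ⊙ₘ uJ C ◁ₒ εμ A) ≫ (uJ C ⊚ X) ◁ᵦ ϖ := by
    rw [← Bul.tensorHom_def, Bul.tensorHom_comp_tensorHom, Circ.triangle_inv, Jεμ,
      Iso.inv_hom_id_assoc, ← Bul.id_tensorHom, Bul.tensorHom_comp_tensorHom, Category.comp_id]
  have h5 : ζ (uJ C) (uJ C) (uI C ⊚ X) (A ⊚ A) ≫ (uJ C ◁ₒ (lunitO X).hom ⊙ₘ uJ C ◁ₒ εμ A) =
      (uJ C ⊙ uJ C) ◁ₒ ((lunitO X).hom ⊙ₘ εμ A) ≫ ζ (uJ C) (uJ C) X (uJ C) := by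
    have := ζ_natural (𝟙 (uJ C)) (𝟙 (uJ C)) (lunitO X).hom (εμ A)
    rw [Bul.tensorHom_id, Bul.id_whiskerRight, Circ.id_tensorHom, Circ.id_tensorHom,
      Circ.id_tensorHom] at this
    exact this.symm
  rw [evalJεμ, ← Category.assoc, ← Circ.comp_whiskerRight, leftO_toAIA_lunitB_inv,
    Circ.comp_whiskerRight, Circ.comp_whiskerRight]
  simp only [Category.assoc]
  rw [reassoc_of% (ζ_natural₁ (runitO (uJ C)).hom (uJ C ⊚ A) X A), reassoc_of% h2,
    reassoc_of% h4, reassoc_of% h5,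
    reassoc_of% (Circ.associator_naturality_left (lunitB (uJ C)).inv (uI C ⊙ A) (X ⊙ A)),
    ← reassoc_of% (Circ.whisker_exchange (lunitB (uJ C)).inv (ζ (uI C) A X A)),
    ← reassoc_of% (Circ.whisker_exchange (lunitB (uJ C)).inv ((lunitO X).hom ⊙ₘ εμ A)),
    lunitB_inv_ζ_runitB, Bul.tensorHom_def]
  simp only [Circ.whiskerLeft_comp, Category.assoc]

lemma leftO_toAIA_comparison :
    uJ C ◁ₒ toAIA A ≫ comparison A = uJ C ◁ₒ sqcapRb A := by
  have h : (runitO (uJ C ⊚ (uI C ⊙ A))).inv = uJ C ◁ₒ (runitO (uI C ⊙ A)).inv ≫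
      (assocO (uJ C) (uI C ⊙ A) (uI C)).inv :=
    @MonoidalCategory.rightUnitor_tensor_inv C _ TwoMonoidal.circ _ _
  rw [comparison, comp_evalJεμ, leftO_toAIA_evalJεμ,
    reassoc_of% (Circ.associator_naturality_right (uJ C) (uI C ⊙ A) (IΔη A)), h, sqcapRb]
  simp only [Circ.whiskerLeft_comp, Category.assoc, Iso.inv_hom_id_assoc]

/-- If `J ⊚ f` has the inverse `w` modulo the idempotent `sqcapRo A`, then it induces an
isomorphism of bimodules. -/
theorem Ro.isoAsBimodules (hc : AxLLC A) (R : Splitting (sqcapRo A)) {M : PreMon C}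
    (hM : M.IsMonoid) (f : M.X ⟶ A) (hf : M.mul ≫ f = (f ⊚ₘ f) ≫ μA A)
    (w : uJ C ⊚ A ⟶ uJ C ⊚ M.X) (h1 : uJ C ◁ₒ f ≫ w = 𝟙 _) (h2 : sqcapRo A ≫ w = w)
    (h3 : R.ι ≫ w ≫ uJ C ◁ₒ f ≫ R.π = 𝟙 _) :
    IsoAsBimodules (Ro.bimod R M f) (Jtensor M) := by
  let φ : uJ C ⊚ M.X ≅ R.obj :=
    { hom := uJ C ◁ₒ f ≫ R.π
      inv := R.ι ≫ w
      hom_inv_id := by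
        rw [Category.assoc, ← Category.assoc R.π, R.π_ι, h2, h1]
      inv_hom_id := by rw [Category.assoc, h3] }
  -- These two absorptions make `π` linear for the actions of `J` and `A`, which leaves only the
  -- linearity of `J ∘ f`.
  have e1 : uJ C ◁ₒ sqcapRo A ≫ actJA A ≫ R.π = actJA A ≫ R.π := by
    have := actJA_sqcapRo hc =≫ R.π
    simpa only [Category.assoc, R.comp_π] using this
  have e2 : sqcapRo A ▷ₒ A ≫ JAact A ≫ R.π = JAact A ≫ R.π := by
    have := JAact_sqcapRo hc =≫ R.π
    simpa only [Category.assoc, R.comp_π] using this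
  refine isoAsBimodules_of_iso (Jtensor_isBimodule hM) φ ?_ ?_
  · change uJ C ◁ₒ (uJ C ◁ₒ f ≫ R.π) ≫ uJ C ◁ₒ R.ι ≫ (assocO (uJ C) (uJ C) A).inv ≫ ϖ ▷ₒ A ≫ R.π
      = ((assocO (uJ C) (uJ C) M.X).inv ≫ ϖ ▷ₒ M.X) ≫ uJ C ◁ₒ f ≫ R.π
    have e3 : uJ C ◁ₒ R.π ≫ uJ C ◁ₒ R.ι = uJ C ◁ₒ sqcapRo A := by
      rw [← Circ.whiskerLeft_comp, R.π_ι]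
    have e4 : uJ C ◁ₒ sqcapRo A ≫ (assocO (uJ C) (uJ C) A).inv ≫ ϖ ▷ₒ A ≫ R.π =
        (assocO (uJ C) (uJ C) A).inv ≫ ϖ ▷ₒ A ≫ R.π := by
      simpa only [actJA, Category.assoc] using e1
    rw [Circ.whiskerLeft_comp, Category.assoc, reassoc_of% e3, e4, Category.assoc,
      reassoc_of% (Circ.associator_inv_naturality_right (uJ C) (uJ C) f),
      reassoc_of% (Circ.whisker_exchange ϖ f)]
  · change (uJ C ◁ₒ f ≫ R.π) ▷ₒ M.X ≫ R.obj ◁ₒ f ≫ R.ι ▷ₒ A ≫ (assocO (uJ C) A A).hom ≫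
        uJ C ◁ₒ μA A ≫ R.π =
      ((assocO (uJ C) M.X M.X).hom ≫ uJ C ◁ₒ M.mul) ≫ uJ C ◁ₒ f ≫ R.π
    have e3 : R.π ▷ₒ A ≫ R.ι ▷ₒ A = sqcapRo A ▷ₒ A := by
      rw [← Circ.comp_whiskerRight, R.π_ι]
    have e4 : sqcapRo A ▷ₒ A ≫ (assocO (uJ C) A A).hom ≫ uJ C ◁ₒ μA A ≫ R.π =
        (assocO (uJ C) A A).hom ≫ uJ C ◁ₒ μA A ≫ R.π := by
      simpa only [JAact, Category.assoc] using e2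
    have e5 : uJ C ◁ₒ M.mul ≫ uJ C ◁ₒ f = uJ C ◁ₒ (f ▷ₒ M.X) ≫ uJ C ◁ₒ (A ◁ₒ f) ≫
        uJ C ◁ₒ μA A := by
      rw [← Circ.whiskerLeft_comp, hf, Circ.tensorHom_def]
      simp only [Circ.whiskerLeft_comp, Category.assoc]
    rw [Category.assoc, reassoc_of% e5, Circ.comp_whiskerRight, Category.assoc,
      ← reassoc_of% (Circ.whisker_exchange R.π f), reassoc_of% e3, e4,
      ← reassoc_of% (Circ.associator_naturality_middle (uJ C) f M.X),
      ← reassoc_of% (Circ.associator_naturality_right (uJ C) A f)]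

theorem Ro_iso_Jtensor_Rb (hA : IsWeakBimonoid A) (R : Splitting (sqcapRo A))
    (S : Splitting (sqcapRb A)) :
    IsoAsBimodules (Ro.bimod R (Rb.mon S) (Rb.toA S)) (Jtensor (Rb.mon S)) := by
  have e : uJ C ◁ₒ S.π ≫ uJ C ◁ₒ (S.ι ≫ toAIA A) = uJ C ◁ₒ sqcapRb A ≫ uJ C ◁ₒ toAIA A := by
    rw [← Circ.whiskerLeft_comp, ← Category.assoc, S.π_ι, Circ.whiskerLeft_comp]
  refine Ro.isoAsBimodules hA.right.llc R (Rb.isMonoid S hA.right.wb hA.right.rru hA.left.rlu) _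
    (Rb.mul_toA S hA.right.wb hA.right.rru hA.left.rlu) (comparison A ≫ uJ C ◁ₒ S.π) ?_ ?_ ?_
  · change uJ C ◁ₒ (S.ι ≫ toAIA A) ≫ comparison A ≫ uJ C ◁ₒ S.π = 𝟙 (uJ C ⊚ S.obj)
    rw [Circ.whiskerLeft_comp, Category.assoc, reassoc_of% (leftO_toAIA_comparison (A := A)),
      ← Circ.whiskerLeft_comp, ← Circ.whiskerLeft_comp, S.comp_π, S.ι_π, Circ.whiskerLeft_id]
  · rw [reassoc_of% (sqcapRo_comparison hA.right.llc)]
  · change R.ι ≫ (comparison A ≫ uJ C ◁ₒ S.π) ≫ uJ C ◁ₒ (S.ι ≫ toAIA A) ≫ R.π = 𝟙 _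
    rw [Category.assoc, reassoc_of% e, reassoc_of% (comparison_sqcapRb hA.right.rru),
      reassoc_of% (comparison_toAIA (A := A)), R.comp_π, R.ι_π]

/-- The reversal of both products. -/
@[reducible]
def revBoth (d : DuoidalCategory C) : DuoidalCategory C := revO (revB d)

/-- The data of `A` after reversal of both products. -/
@[reducible]
def revBothMonComon (A : C) [MonComon A] : @MonComon C _ (revBoth d) A :=
  @revOMonComon C _ (revB d) A (revBMonComon A)

lemma isMonoid_of_revBoth {M : PreMon C}
    (h : @PreMon.IsMonoid C _ (revBoth d) (@PreMon.mk C _ (revBoth d) M.X M.mul M.one)) :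
    M.IsMonoid := by
  obtain ⟨m, h1, h2⟩ := h
  obtain ⟨X, mul, one⟩ := M
  refine ⟨@MonObj.mk C _ TwoMonoidal.circ X one mul ?_ ?_ ?_, rfl, rfl⟩
  · have := @MonObj.mul_one C _ (revBoth d).circ X m
    rw [h1, h2] at this
    exact this
  · have := @MonObj.one_mul C _ (revBoth d).circ X m
    rw [h1, h2] at this
    exact this
  · have := @MonObj.mul_assoc C _ (revBoth d).circ X m
    rw [h1] at this
    have h3 : X ◁ₒ mul ≫ mul = (assocO X X X).inv ≫ mul ▷ₒ X ≫ mul := this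
    change mul ▷ₒ X ≫ mul = (assocO X X X).hom ≫ X ◁ₒ mul ≫ mul
    rw [h3, Iso.hom_inv_id_assoc]

theorem Lb.isMonoid (hA : IsWeakBimonoid A) (L : Splitting (sqcapLb A)) : (Lb.mon L).IsMonoid :=
  isMonoid_of_revBoth (@Rb.isMonoid C _ (revBoth d) A (revBothMonComon A) L hA.right.wb
    hA.left.llu hA.right.lru)

lemma Lb.mul_toA (hA : IsWeakBimonoid A) (L : Splitting (sqcapLb A)) :
    (Lb.mon L).mul ≫ Lb.toA L = (Lb.toA L ⊚ₘ Lb.toA L) ≫ μA A :=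
  @Rb.mul_toA C _ (revBoth d) A (revBothMonComon A) L hA.right.wb hA.left.llu hA.right.lru

/-- In the `•`-reversed category the comparison composes to `p' : a ↦ ε(a 1_1) 1_2` and `q'`,
whereas `L_•` splits `a ↦ ε(1_1 a) 1_2` and `R_∘` splits the unreversed `sqcapRo`. Absorption
between these idempotents bridges the mismatch. -/
theorem Ro_iso_Jtensor_Lb (hA : IsWeakBimonoid A) (R : Splitting (sqcapRo A))
    (L : Splitting (sqcapLb A)) :
    IsoAsBimodules (Ro.bimod R (Lb.mon L) (Lb.toA L)) (Jtensor (Lb.mon L)) := by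
  let q' : uJ C ⊚ A ⟶ uJ C ⊚ A := @sqcapRo C _ (revB d) A (revBMonComon A)
  let w' : uJ C ⊚ A ⟶ uJ C ⊚ (A ⊙ uI C) := @comparison C _ (revB d) A (revBMonComon A)
  let p' : A ⊙ uI C ⟶ A ⊙ uI C := @sqcapRb C _ (revB d) A (revBMonComon A)
  let t : A ⊙ uI C ⟶ A := A ◁ᵦ τ ≫ (runitB A).hom
  have f1 : uJ C ◁ₒ t ≫ w' = uJ C ◁ₒ p' :=
    @leftO_toAIA_comparison C _ (revB d) A (revBMonComon A)
  have f2 : w' ≫ uJ C ◁ₒ sqcapLb A = w' :=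
    @comparison_sqcapRb' C _ (revB d) A (revBMonComon A) hA.left.llu
  have f3 : w' ≫ uJ C ◁ₒ t = q' := @comparison_toAIA C _ (revB d) A (revBMonComon A)
  have f4 : sqcapLb A ≫ p' = sqcapLb A :=
    @sqcapRb'_sqcapRb C _ (revB d) A (revBMonComon A) hA.right.lru
  -- Reversing `•` changes neither `J ∘ A` nor `Jεμ`, so (LLC) also controls precomposition of the
  -- reversed comparison with `sqcapRo`.
  have f5 : sqcapRo A ≫ w' = w' := by
    have h : sqcapRo A ▷ₒ A ≫ Jεμ A = 𝟙 (uJ C ⊚ A) ▷ₒ A ≫ Jεμ A := by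
      rw [sqcapRo_Jεμ hA.right.llc, Circ.id_whiskerRight, Category.id_comp]
    exact (@comp_comparison_congr C _ (revB d) A (revBMonComon A) _ (sqcapRo A) (𝟙 _) h).trans
      (Category.id_comp _)
  -- By (LRC) the reversed idempotent is invisible to `Jεμ`, hence to `sqcapRo`.
  have f6 : q' ≫ sqcapRo A = sqcapRo A := by
    have h : q' ▷ₒ A ≫ Jεμ A = 𝟙 (uJ C ⊚ A) ▷ₒ A ≫ Jεμ A := by
      rw [Circ.id_whiskerRight, Category.id_comp]
      exact @sqcapRo_Jεμ C _ (revB d) A (revBMonComon A) hA.right.lrc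
    rw [comp_sqcapRo_congr h, Category.id_comp]
  have f7 : L.ι ≫ p' = L.ι := by
    rw [← L.ι_comp, Category.assoc, f4]
  have e : uJ C ◁ₒ L.π ≫ uJ C ◁ₒ (L.ι ≫ t) = uJ C ◁ₒ sqcapLb A ≫ uJ C ◁ₒ t := by
    rw [← Circ.whiskerLeft_comp, ← Category.assoc, L.π_ι, Circ.whiskerLeft_comp]
  refine Ro.isoAsBimodules hA.right.llc R (Lb.isMonoid hA L) _ (Lb.mul_toA hA L)
    (w' ≫ uJ C ◁ₒ L.π) ?_ ?_ ?_
  · change uJ C ◁ₒ (L.ι ≫ t) ≫ w' ≫ uJ C ◁ₒ L.π = 𝟙 (uJ C ⊚ L.obj)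
    rw [Circ.whiskerLeft_comp, Category.assoc, reassoc_of% f1,
      ← Circ.whiskerLeft_comp, ← Circ.whiskerLeft_comp, ← Category.assoc, f7, L.ι_π,
      Circ.whiskerLeft_id]
  · rw [reassoc_of% f5]
  · change R.ι ≫ (w' ≫ uJ C ◁ₒ L.π) ≫ uJ C ◁ₒ (L.ι ≫ t) ≫ R.π = 𝟙 _
    rw [Category.assoc, reassoc_of% e, reassoc_of% f2, reassoc_of% f3, ← R.comp_π,
      reassoc_of% f6, R.comp_π, R.ι_π]

end Comparison

end Duoidal

namespace Duoidal

open DuoidalCategory Opposite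

/-! ### Transport of the results along the symmetries. -/

section Transfer

variable {C : Type u} [Category.{v} C] [d : DuoidalCategory C]

lemma isBimodule_of_revBoth {M N : PreMon C} {P : PreBimod M N}
    (h : @PreBimod.IsBimodule C _ (revBoth d) (@PreMon.mk C _ (revBoth d) N.X N.mul N.one)
      (@PreMon.mk C _ (revBoth d) M.X M.mul M.one)
      (@PreBimod.mk C _ (revBoth d) _ _ P.X P.right P.left)) : P.IsBimodule := by
  obtain ⟨h1, h2, h3, h4, h5⟩ := h
  refine ⟨h3, h4, h1, h2, ?_⟩
  have h' : M.X ◁ₒ P.right ≫ P.left =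
      (assocO M.X P.X N.X).inv ≫ P.left ▷ₒ N.X ≫ P.right := h5
  rw [h', Iso.hom_inv_id_assoc]

lemma isoAsBimodules_of_revBoth {M N : PreMon C} {P Q : PreBimod M N}
    (h : @IsoAsBimodules C _ (revBoth d) (@PreMon.mk C _ (revBoth d) N.X N.mul N.one)
      (@PreMon.mk C _ (revBoth d) M.X M.mul M.one)
      (@PreBimod.mk C _ (revBoth d) _ _ P.X P.right P.left)
      (@PreBimod.mk C _ (revBoth d) _ _ Q.X Q.right Q.left)) : IsoAsBimodules P Q := by
  obtain ⟨h1, h2, e, h3, h4⟩ := h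
  exact ⟨isBimodule_of_revBoth h1, isBimodule_of_revBoth h2, e, h4, h3⟩

lemma isComonoid_of_revBoth {M : PreComon C}
    (h : @PreComon.IsComonoid C _ (revBoth d) (@PreComon.mk C _ (revBoth d) M.X M.comul M.counit)) :
    M.IsComonoid := by
  obtain ⟨m, h1, h2⟩ := h
  obtain ⟨X, comul, counit⟩ := M
  refine ⟨@ComonObj.mk C _ TwoMonoidal.bul X counit comul ?_ ?_ ?_, rfl, rfl⟩
  · have := @ComonObj.comul_counit C _ (revBoth d).bul X m
    rw [h1, h2] at this
    exact this
  · have := @ComonObj.counit_comul C _ (revBoth d).bul X m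
    rw [h1, h2] at this
    exact this
  · have := @ComonObj.comul_assoc C _ (revBoth d).bul X m
    rw [h1] at this
    have h3 : comul ≫ comul ▷ᵦ X = comul ≫ X ◁ᵦ comul ≫ (assocB X X X).inv := this
    change comul ≫ X ◁ᵦ comul = comul ≫ comul ▷ᵦ X ≫ (assocB X X X).hom
    rw [reassoc_of% h3, Iso.inv_hom_id, Category.comp_id]

lemma isBicomodule_of_revBoth {M N : PreComon C} {P : PreBicomod M N}
    (h : @PreBicomod.IsBicomodule C _ (revBoth d)
      (@PreComon.mk C _ (revBoth d) N.X N.comul N.counit)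
      (@PreComon.mk C _ (revBoth d) M.X M.comul M.counit)
      (@PreBicomod.mk C _ (revBoth d) _ _ P.X P.right P.left)) : P.IsBicomodule := by
  obtain ⟨h1, h2, h3, h4, h5⟩ := h
  refine ⟨h3, h4, h1, h2, ?_⟩
  have h' : P.left ≫ M.X ◁ᵦ P.right =
    P.right ≫ P.left ▷ᵦ N.X ≫ (assocB M.X P.X N.X).hom := h5
  rw [reassoc_of% h', Iso.hom_inv_id, Category.comp_id]

lemma isoAsBicomodules_of_revBoth {M N : PreComon C} {P Q : PreBicomod M N}
    (h : @IsoAsBicomodules C _ (revBoth d) (@PreComon.mk C _ (revBoth d) N.X N.comul N.counit)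
      (@PreComon.mk C _ (revBoth d) M.X M.comul M.counit)
      (@PreBicomod.mk C _ (revBoth d) _ _ P.X P.right P.left)
      (@PreBicomod.mk C _ (revBoth d) _ _ Q.X Q.right Q.left)) : IsoAsBicomodules P Q := by
  obtain ⟨h1, h2, e, h3, h4⟩ := h
  exact ⟨isBicomodule_of_revBoth h1, isBicomodule_of_revBoth h2, e, h4, h3⟩

/-- A comonoid, seen as a monoid in the dual duoidal category. -/
@[reducible]
def PreComon.dual (M : PreComon C) : @PreMon Cᵒᵖ _ (dualDuoidal d) :=
  @PreMon.mk Cᵒᵖ _ (dualDuoidal d) (op M.X) M.comul.op M.counit.op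

/-- A bicomodule, seen as a bimodule in the dual duoidal category. -/
@[reducible]
def PreBicomod.dual {M N : PreComon C} (P : PreBicomod M N) :
    @PreBimod Cᵒᵖ _ (dualDuoidal d) M.dual N.dual :=
  @PreBimod.mk Cᵒᵖ _ (dualDuoidal d) M.dual N.dual (op P.X) P.left.op P.right.op

lemma isComonoid_of_dual {M : PreComon C}
    (h : @PreMon.IsMonoid Cᵒᵖ _ (dualDuoidal d) M.dual) : M.IsComonoid := by
  obtain ⟨m, h1, h2⟩ := h
  obtain ⟨X, comul, counit⟩ := M
  refine ⟨@ComonObj.mk C _ TwoMonoidal.bul X counit comul ?_ ?_ ?_, rfl, rfl⟩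
  · have := @MonObj.one_mul Cᵒᵖ _ (dualDuoidal d).circ (op X) m
    rw [h1, h2] at this
    exact congrArg Quiver.Hom.unop this
  · have := @MonObj.mul_one Cᵒᵖ _ (dualDuoidal d).circ (op X) m
    rw [h1, h2] at this
    exact congrArg Quiver.Hom.unop this
  · have := @MonObj.mul_assoc Cᵒᵖ _ (dualDuoidal d).circ (op X) m
    rw [h1] at this
    have h3 : comul ≫ comul ▷ᵦ X = (comul ≫ X ◁ᵦ comul) ≫ (assocB X X X).inv :=
      congrArg Quiver.Hom.unop this
    change comul ≫ X ◁ᵦ comul = comul ≫ comul ▷ᵦ X ≫ (assocB X X X).hom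
    rw [reassoc_of% h3, Iso.inv_hom_id, Category.comp_id]

lemma isBicomodule_of_dual {M N : PreComon C} {P : PreBicomod M N}
    (h : @PreBimod.IsBimodule Cᵒᵖ _ (dualDuoidal d) _ _ P.dual) : P.IsBicomodule := by
  obtain ⟨h1, h2, h3, h4, h5⟩ := h
  exact ⟨congrArg Quiver.Hom.unop h1, (congrArg Quiver.Hom.unop h2).trans (Category.assoc _ _ _),
    congrArg Quiver.Hom.unop h3, (congrArg Quiver.Hom.unop h4).trans (Category.assoc _ _ _),
    (congrArg Quiver.Hom.unop h5).trans (Category.assoc _ _ _)⟩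

lemma isoAsBicomodules_of_dual {M N : PreComon C} {P Q : PreBicomod M N}
    (h : @IsoAsBimodules Cᵒᵖ _ (dualDuoidal d) _ _ P.dual Q.dual) : IsoAsBicomodules P Q := by
  obtain ⟨h1, h2, e, h3, h4⟩ := h
  refine ⟨isBicomodule_of_dual h1, isBicomodule_of_dual h2, e.unop.symm, ?_, ?_⟩
  · have h5 : e.hom.unop ≫ P.left = Q.left ≫ M.X ◁ᵦ e.hom.unop := congrArg Quiver.Hom.unop h3
    have h6 : M.X ◁ᵦ e.hom.unop ≫ M.X ◁ᵦ e.inv.unop = 𝟙 _ := by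
      rw [← Bul.whiskerLeft_comp]
      exact (congrArg _ (congrArg Quiver.Hom.unop e.inv_hom_id)).trans (Bul.whiskerLeft_id _ _)
    have h7 : e.inv.unop ≫ e.hom.unop = 𝟙 _ := congrArg Quiver.Hom.unop e.hom_inv_id
    change P.left ≫ M.X ◁ᵦ e.inv.unop = e.inv.unop ≫ Q.left
    rw [← Category.id_comp P.left]
    rw [← h7, Category.assoc, Category.assoc, reassoc_of% h5, h6, Category.comp_id]
  · have h5 : e.hom.unop ≫ P.right = Q.right ≫ e.hom.unop ▷ᵦ N.X := congrArg Quiver.Hom.unop h4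
    have h6 : e.hom.unop ▷ᵦ N.X ≫ e.inv.unop ▷ᵦ N.X = 𝟙 _ := by
      rw [← Bul.comp_whiskerRight]
      exact (congrArg (fun f => rightB f N.X) (congrArg Quiver.Hom.unop e.inv_hom_id)).trans
        (Bul.id_whiskerRight _ _)
    have h7 : e.inv.unop ≫ e.hom.unop = 𝟙 _ := congrArg Quiver.Hom.unop e.hom_inv_id
    change P.right ≫ e.inv.unop ▷ᵦ N.X = e.inv.unop ≫ Q.right
    rw [← Category.id_comp P.right]
    rw [← h7, Category.assoc, Category.assoc, reassoc_of% h5, h6, Category.comp_id]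

/-- A splitting, seen in the opposite category. -/
@[reducible]
def Splitting.dual {X : C} {p : X ⟶ X} (S : Splitting p) {p' : op X ⟶ op X} (h : p' = p.op) :
    Splitting p' where
  obj := op S.obj
  ι := S.π.op
  π := S.ι.op
  ι_π := Quiver.Hom.unop_inj S.ι_π
  π_ι := h ▸ Quiver.Hom.unop_inj S.π_ι

variable {A : C} [MonComon A]

lemma sqcapRb_dual :
    @sqcapRb Cᵒᵖ _ (dualDuoidal d) (op A) (dualMonComon A) = (sqcapRo A).op := by
  refine Quiver.Hom.unop_inj ?_
  change (((((runitO (uJ C ⊚ A)).inv ≫ (uJ C ⊚ A) ◁ₒ Δη A) ≫ (lunitB (uJ C ⊚ A)).inv ▷ₒ (A ⊙ A)) ≫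
    ζ (uJ C) (uJ C ⊚ A) A A) ≫ (uJ C ⊚ A) ◁ᵦ (((assocO (uJ C) A A).hom ≫ uJ C ◁ₒ εμ A) ≫ ϖ)) ≫
      (runitB (uJ C ⊚ A)).hom = sqcapRo A
  simp only [sqcapRo, Jεμ, Category.assoc]

lemma sqcapLb_dual :
    @sqcapLb Cᵒᵖ _ (dualDuoidal d) (op A) (dualMonComon A) = (sqcapLo A).op := by
  refine Quiver.Hom.unop_inj ?_
  change (((((lunitO (A ⊚ uJ C)).inv ≫ Δη A ▷ₒ (A ⊚ uJ C)) ≫ (A ⊙ A) ◁ₒ (runitB (A ⊚ uJ C)).inv) ≫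
    ζ A A (A ⊚ uJ C) (uJ C)) ≫ (((assocO A A (uJ C)).inv ≫ εμ A ▷ₒ uJ C) ≫ ϖ) ▷ᵦ (A ⊚ uJ C)) ≫
      (lunitB (A ⊚ uJ C)).hom = sqcapLo A
  simp only [sqcapLo, εμJ, Category.assoc]

lemma sqcapRo_dual :
    @sqcapRo Cᵒᵖ _ (dualDuoidal d) (op A) (dualMonComon A) = (sqcapRb A).op := by
  refine Quiver.Hom.unop_inj ?_
  change (((((runitO (uI C ⊙ A)).inv ≫ (uI C ⊙ A) ◁ₒ ((δ ≫ uI C ◁ᵦ Δη A) ≫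
    (assocB (uI C) A A).inv)) ≫ ζ (uI C) A (uI C ⊙ A) A) ≫ (lunitO (uI C ⊙ A)).hom ▷ᵦ (A ⊚ A)) ≫
      (uI C ⊙ A) ◁ᵦ εμ A) ≫ (runitB (uI C ⊙ A)).hom = sqcapRb A
  simp only [sqcapRb, IΔη, Category.assoc]

/-- In the dual category the structure maps equal the opposites of the intended ones only after
reassociation. This lemma and the next two take the maps as variables with equations, so that no
transport along equalities of structures is needed. -/
lemma Rb_isMonoid_of_eq (hA : IsWeakBimonoid A) (S : Splitting (sqcapRb A))
    {m : S.obj ⊚ S.obj ⟶ S.obj} (hm : (Rb.mon S).mul = m)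
    {u : uI C ⟶ S.obj} (hu : (Rb.mon S).one = u) : (PreMon.mk S.obj m u).IsMonoid := by
  subst hm hu
  exact Rb.isMonoid S hA.right.wb hA.right.rru hA.left.rlu

lemma Ro_iso_Jtensor_Rb_of_eq (hA : IsWeakBimonoid A) (R : Splitting (sqcapRo A))
    (S : Splitting (sqcapRb A)) {m : S.obj ⊚ S.obj ⟶ S.obj} (hm : (Rb.mon S).mul = m)
    {u : uI C ⟶ S.obj} (hu : (Rb.mon S).one = u) {f : S.obj ⟶ A} (hf : Rb.toA S = f)
    {l : uJ C ⊚ R.obj ⟶ R.obj} (hl : Ro.actJ R = l) {r : R.obj ⊚ A ⟶ R.obj} (hr : Ro.act R = r) :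
    IsoAsBimodules (PreBimod.mk (M := monJ C) (N := ⟨S.obj, m, u⟩) R.obj l (R.obj ◁ₒ f ≫ r))
      (Jtensor ⟨S.obj, m, u⟩) := by
  subst hm hu hf hl hr
  exact Ro_iso_Jtensor_Rb hA R S

lemma Ro_iso_Jtensor_Lb_of_eq (hA : IsWeakBimonoid A) (R : Splitting (sqcapRo A))
    (S : Splitting (sqcapLb A)) {m : S.obj ⊚ S.obj ⟶ S.obj} (hm : (Lb.mon S).mul = m)
    {u : uI C ⟶ S.obj} (hu : (Lb.mon S).one = u) {f : S.obj ⟶ A} (hf : Lb.toA S = f)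
    {l : uJ C ⊚ R.obj ⟶ R.obj} (hl : Ro.actJ R = l) {r : R.obj ⊚ A ⟶ R.obj} (hr : Ro.act R = r) :
    IsoAsBimodules (PreBimod.mk (M := monJ C) (N := ⟨S.obj, m, u⟩) R.obj l (R.obj ◁ₒ f ≫ r))
      (Jtensor ⟨S.obj, m, u⟩) := by
  subst hm hu hf hl hr
  exact Ro_iso_Jtensor_Lb hA R S

/-! ### Base comonoids and bicomodules as duals of base monoids and bimodules. -/

section DualStructures

variable (R : Splitting (sqcapRo A)) (L : Splitting (sqcapLo A)) (S : Splitting (sqcapRb A))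

/-- A splitting of `sqcapRo A` in the dual category. -/
@[reducible]
def Ro.dual : @Splitting Cᵒᵖ _ _ (@sqcapRb Cᵒᵖ _ (dualDuoidal d) (op A) (dualMonComon A)) :=
  R.dual sqcapRb_dual

/-- A splitting of `sqcapLo A` in the dual category. -/
@[reducible]
def Lo.dual : @Splitting Cᵒᵖ _ _ (@sqcapLb Cᵒᵖ _ (dualDuoidal d) (op A) (dualMonComon A)) :=
  L.dual sqcapLb_dual

/-- A splitting of `sqcapRb A` in the dual category. -/
@[reducible]
def Rb.dual : @Splitting Cᵒᵖ _ _ (@sqcapRo Cᵒᵖ _ (dualDuoidal d) (op A) (dualMonComon A)) :=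
  S.dual sqcapRo_dual

lemma Ro.dual_mul :
    @PreMon.mul Cᵒᵖ _ (dualDuoidal d)
      (@Rb.mon Cᵒᵖ _ (dualDuoidal d) (op A) (dualMonComon A) (Ro.dual R)) =
      (Ro.comon R).comul.op := by
  refine Quiver.Hom.unop_inj ?_
  change ((runitB R.obj).inv ≫ R.obj ◁ᵦ (((runitO (uJ C)).inv ≫ uJ C ◁ₒ ηA A) ≫ R.π)) ≫
    (((runitO (R.obj ⊙ R.obj)).inv ≫ (R.obj ⊙ R.obj) ◁ₒ Δη A) ≫ ζ R.obj R.obj A A) ≫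
      ((((R.ι ▷ₒ A ≫ (assocO (uJ C) A A).hom) ≫ uJ C ◁ₒ μA A) ≫ R.π) ⊙ₘ
        (((R.ι ▷ₒ A ≫ (assocO (uJ C) A A).hom) ≫ uJ C ◁ₒ μA A) ≫ R.π)) = _
  simp only [Ro.comon, Ro.χ, Ro.act, Category.assoc]
  rfl

lemma Ro.dual_one :
    @PreMon.one Cᵒᵖ _ (dualDuoidal d)
      (@Rb.mon Cᵒᵖ _ (dualDuoidal d) (op A) (dualMonComon A) (Ro.dual R)) =
      (Ro.comon R).counit.op :=
  Quiver.Hom.unop_inj (Category.assoc R.ι (uJ C ◁ₒ εA A) ϖ)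

lemma Ro.dual_toA :
    @Rb.toA Cᵒᵖ _ (dualDuoidal d) (op A) (dualMonComon A) (Ro.dual R) = (Ro.fromA R).op :=
  Quiver.Hom.unop_inj (Category.assoc (lunitO A).inv (τ ▷ₒ A) R.π)

lemma Lo.dual_mul :
    @PreMon.mul Cᵒᵖ _ (dualDuoidal d)
      (@Lb.mon Cᵒᵖ _ (dualDuoidal d) (op A) (dualMonComon A) (Lo.dual L)) =
      (Lo.comon L).comul.op := by
  refine Quiver.Hom.unop_inj ?_
  change ((lunitB L.obj).inv ≫ (((lunitO (uJ C)).inv ≫ ηA A ▷ₒ uJ C) ≫ L.π) ▷ᵦ L.obj) ≫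
    (((lunitO (L.obj ⊙ L.obj)).inv ≫ Δη A ▷ₒ (L.obj ⊙ L.obj)) ≫ ζ A A L.obj L.obj) ≫
      ((((A ◁ₒ L.ι ≫ (assocO A A (uJ C)).inv) ≫ μA A ▷ₒ uJ C) ≫ L.π) ⊙ₘ
        (((A ◁ₒ L.ι ≫ (assocO A A (uJ C)).inv) ≫ μA A ▷ₒ uJ C) ≫ L.π)) = _
  simp only [Lo.comon, Lo.χ, Lo.act, Category.assoc]
  rfl

lemma Lo.dual_one :
    @PreMon.one Cᵒᵖ _ (dualDuoidal d)
      (@Lb.mon Cᵒᵖ _ (dualDuoidal d) (op A) (dualMonComon A) (Lo.dual L)) =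
      (Lo.comon L).counit.op :=
  Quiver.Hom.unop_inj (Category.assoc L.ι (εA A ▷ₒ uJ C) ϖ)

lemma Lo.dual_toA :
    @Lb.toA Cᵒᵖ _ (dualDuoidal d) (op A) (dualMonComon A) (Lo.dual L) = (Lo.fromA L).op :=
  Quiver.Hom.unop_inj (Category.assoc (runitO A).inv (A ◁ₒ τ) L.π)

lemma Rb.dual_actJ :
    @Ro.actJ Cᵒᵖ _ (dualDuoidal d) (op A) (dualMonComon A) (Rb.dual S) = (Rb.coactI S).op :=
  Quiver.Hom.unop_inj ((Category.assoc (S.ι ≫ δ ▷ᵦ A) (assocB (uI C) (uI C) A).hom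
    (uI C ◁ᵦ S.π)).trans (Category.assoc _ _ _))

lemma Rb.dual_act :
    @Ro.act Cᵒᵖ _ (dualDuoidal d) (op A) (dualMonComon A) (Rb.dual S) = (Rb.coact S).op :=
  Quiver.Hom.unop_inj ((Category.assoc (S.ι ≫ uI C ◁ᵦ ΔA A) (assocB (uI C) A A).inv
    (S.π ▷ᵦ A)).trans (Category.assoc _ _ _))

theorem Ro.isComonoid (hA : IsWeakBimonoid A) : (Ro.comon R).IsComonoid :=
  isComonoid_of_dual (@Rb_isMonoid_of_eq Cᵒᵖ _ (dualDuoidal d) (op A) (dualMonComon A) hA.dual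
    (Ro.dual R) _ (Ro.dual_mul R) _ (Ro.dual_one R))

/-- Duality exchanges `R_∘` with `R_•`, and `J ∘ -` with `I • -`. -/
theorem Rb_iso_Itensor_Ro (hA : IsWeakBimonoid A) :
    IsoAsBicomodules (Rb.bicomod S (Ro.comon R) (Ro.fromA R)) (Itensor (Ro.comon R)) :=
  isoAsBicomodules_of_dual (@Ro_iso_Jtensor_Rb_of_eq Cᵒᵖ _ (dualDuoidal d) (op A)
    (dualMonComon A) hA.dual (Rb.dual S) (Ro.dual R) _ (Ro.dual_mul R) _ (Ro.dual_one R)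
    _ (Ro.dual_toA R) _ (Rb.dual_actJ S) _ (Rb.dual_act S))

theorem Rb_iso_Itensor_Lo (hA : IsWeakBimonoid A) :
    IsoAsBicomodules (Rb.bicomod S (Lo.comon L) (Lo.fromA L)) (Itensor (Lo.comon L)) :=
  isoAsBicomodules_of_dual (@Ro_iso_Jtensor_Lb_of_eq Cᵒᵖ _ (dualDuoidal d) (op A)
    (dualMonComon A) hA.dual (Rb.dual S) (Lo.dual L) _ (Lo.dual_mul L) _ (Lo.dual_one L)
    _ (Lo.dual_toA L) _ (Rb.dual_actJ S) _ (Rb.dual_act S))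

end DualStructures

lemma sqcapRo_idem (h : AxLLC A) : sqcapRo A ≫ sqcapRo A = sqcapRo A := by
  have := comp_sqcapRo_congr (f := sqcapRo A) (g := 𝟙 _)
    (by rw [sqcapRo_Jεμ h, Circ.id_whiskerRight, Category.id_comp])
  rw [this, Category.id_comp]

lemma IsWeakBimonoid.revBoth (h : IsWeakBimonoid A) :
    @IsWeakBimonoid C _ (revBoth d) A (revBothMonComon A) :=
  @IsWeakBimonoid.revO C _ (Duoidal.revB d) A (revBMonComon A) h.revB

end Transfer

end Duoidal

open Duoidal

theorem mainTheorem5 {C : Type u} [Category.{v} C] [DuoidalCategory C] [IsIdempotentComplete C]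
    (A : C) [MonComon A] (hA : IsWeakBimonoid A) :
    -- the four endomorphisms are idempotent, so that the base objects exist
    (sqcapLo A ≫ sqcapLo A = sqcapLo A ∧ sqcapRo A ≫ sqcapRo A = sqcapRo A ∧
      sqcapLb A ≫ sqcapLb A = sqcapLb A ∧ sqcapRb A ≫ sqcapRb A = sqcapRb A) ∧
    -- for every choice of their splittings
    ∀ (L_o : Splitting (sqcapLo A)) (R_o : Splitting (sqcapRo A))
      (L_b : Splitting (sqcapLb A)) (R_b : Splitting (sqcapRb A)),
      ((Lb.mon L_b).IsMonoid ∧ (Rb.mon R_b).IsMonoid ∧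
        (Lo.comon L_o).IsComonoid ∧ (Ro.comon R_o).IsComonoid) ∧
      IsoAsBimodules (Lo.bimod L_o (Lb.mon L_b) (Lb.toA L_b)) (tensorJ (Lb.mon L_b)) ∧
      IsoAsBimodules (Lo.bimod L_o (Rb.mon R_b) (Rb.toA R_b)) (tensorJ (Rb.mon R_b)) ∧
      IsoAsBimodules (Ro.bimod R_o (Rb.mon R_b) (Rb.toA R_b)) (Jtensor (Rb.mon R_b)) ∧
      IsoAsBimodules (Ro.bimod R_o (Lb.mon L_b) (Lb.toA L_b)) (Jtensor (Lb.mon L_b)) ∧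
      IsoAsBicomodules (Lb.bicomod L_b (Lo.comon L_o) (Lo.fromA L_o)) (tensorI (Lo.comon L_o)) ∧
      IsoAsBicomodules (Lb.bicomod L_b (Ro.comon R_o) (Ro.fromA R_o)) (tensorI (Ro.comon R_o)) ∧
      IsoAsBicomodules (Rb.bicomod R_b (Ro.comon R_o) (Ro.fromA R_o)) (Itensor (Ro.comon R_o)) ∧
      IsoAsBicomodules (Rb.bicomod R_b (Lo.comon L_o) (Lo.fromA L_o)) (Itensor (Lo.comon L_o)) := by
  have hA' := hA.revBoth
  -- The statements with `R_∘` or `R_•` on the left are already available; reversing both products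
  -- yields those with `L_∘` or `L_•`.
  refine ⟨⟨@sqcapRo_idem C _ (revBoth _) A (revBothMonComon A) hA.left.rrc,
    sqcapRo_idem hA.right.llc, @sqcapRb_idem C _ (revBoth _) A (revBothMonComon A) hA.left.llu,
    sqcapRb_idem hA.right.rru⟩, fun L_o R_o L_b R_b => ⟨⟨Lb.isMonoid hA L_b,
      Rb.isMonoid R_b hA.right.wb hA.right.rru hA.left.rlu, ?_, Ro.isComonoid R_o hA⟩,
      ?_, ?_, Ro_iso_Jtensor_Rb hA R_o R_b, Ro_iso_Jtensor_Lb hA R_o L_b, ?_, ?_,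
      Rb_iso_Itensor_Ro R_o R_b hA, Rb_iso_Itensor_Lo L_o R_b hA⟩⟩
  · exact isComonoid_of_revBoth (@Ro.isComonoid C _ (revBoth _) A (revBothMonComon A) L_o hA')
  · exact isoAsBimodules_of_revBoth
      (@Ro_iso_Jtensor_Rb C _ (revBoth _) A (revBothMonComon A) hA' L_o L_b)
  · exact isoAsBimodules_of_revBoth
      (@Ro_iso_Jtensor_Lb C _ (revBoth _) A (revBothMonComon A) hA' L_o R_b)
  · exact isoAsBicomodules_of_revBoth
      (@Rb_iso_Itensor_Ro C _ (revBoth _) A (revBothMonComon A) L_o L_b hA')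
  · exact isoAsBicomodules_of_revBoth
      (@Rb_iso_Itensor_Lo C _ (revBoth _) A (revBothMonComon A) R_o L_b hA')
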